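/- Let $R>0$, $0<m\le M$ and $K_1,K_2,L\ge 0$, and let $B_R(0)\subset\mathbb{R}^2$ be the open disc of radius $R$ centred at the origin. There is a constant $C>0$, depending only on $m,M,R,K_1,K_2,L$, such that the following holds. Let $u\in C^4(B_R(0))$ be a convex solution of the two-dimensional prescribed Gauss curvature equation $$\frac{\det\nabla^2u}{(1+|\nabla u|^2)^2}=f(x)\quad\text{in } B_R(0),$$ where $m\le f\le M$ in $B_R(0)$, and suppose that $\sup_{B_R(0)}|\nabla f|\le K_1$, $\sup_{B_R(0)}|\nabla^2f|\le K_2$ and $\sup_{B_R(0)}|\nabla u|\le L$. Then $$|\nabla^2u(0)|\le C.$$ Here $|\nabla^2 u|$ and $|\nabla^2 f|$ denote the Euclidean (Frobenius) norm of the Hessian matrix. -/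

import Mathlib

/-- The Hessian matrix `(∂ᵢ∂ⱼ u (x))` of a function on the Euclidean plane. -/
noncomputable def hessian (u : EuclideanSpace ℝ (Fin 2) → ℝ) (x : EuclideanSpace ℝ (Fin 2)) :
    Matrix (Fin 2) (Fin 2) ℝ :=
  Matrix.of fun i j =>
    fderiv ℝ (fderiv ℝ u) x (EuclideanSpace.single i 1) (EuclideanSpace.single j 1)

/-- The Euclidean (Frobenius) norm `|∇²u(x)|` of the Hessian matrix. -/
noncomputable def hessianNorm (u : EuclideanSpace ℝ (Fin 2) → ℝ) (x : EuclideanSpace ℝ (Fin 2)) :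
    ℝ :=
  Real.sqrt (∑ i, ∑ j, hessian u x i j ^ 2)

/-- `u` solves the prescribed Gauss curvature equation
`det ∇²u / (1 + |∇u|²)² = f` in the open disc `B_R(0)` of the plane. -/
def SolvesGaussCurvatureEq (u f : EuclideanSpace ℝ (Fin 2) → ℝ) (R : ℝ) : Prop :=
  ∀ x ∈ Metric.ball (0 : EuclideanSpace ℝ (Fin 2)) R,
    (hessian u x).det / (1 + ‖gradient u x‖ ^ 2) ^ 2 = f x

/-!
The proof combines strict convexity with Pogorelov's interior estimate. In dimension two a convex
function with Hessian determinant at least `m` and gradient at most `L` cannot stay close to its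
tangent plane at `0` along a segment from `0` to the circle `|x| = R / 2`: otherwise comparison with
an explicit barrier on a rectangle having that segment as one side would push it below the tangent
plane. Hence for some `δ` depending only on `m`, `R`, `L`, the section on which the weight
`w = δ + u 0 + ∇u 0 ⬝ x - u x` is positive is compactly contained in the disc of radius `R / 2`,
while `w 0 = δ`.

On this section, maximise `∂ξξ u * w ^ 2 * exp (K |∇u|² / 2)` over points and unit directions `ξ`.
At the maximum `ξ` is an eigenvector of the Hessian, with eigenvalue `A`, and the twice
differentiated equation eliminates the derivatives of order four. The third-order derivatives are
absorbed by means of the vanishing of the gradient, and for large `K` the term `K |∇u|² / 2`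
dominates the remaining ones, leaving `A * w ≤ C`. This bounds the test function at the maximum,
hence at the origin.
-/

open Filter Topology Metric
open scoped RealInnerProductSpace

/-- `g` is differentiable near `t₀`, twice differentiable at `t₀`, and its value, first and second
derivative there are `a`, `b` and `c`. -/
def HasTwoJetAt (g : ℝ → ℝ) (a b c t₀ : ℝ) : Prop :=
  g t₀ = a ∧ ∃ g' : ℝ → ℝ, (∀ᶠ t in 𝓝 t₀, HasDerivAt g (g' t) t) ∧ g' t₀ = b ∧ HasDerivAt g' c t₀

namespace HasTwoJetAt

variable {g h : ℝ → ℝ} {a b c a' b' c' t₀ : ℝ}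

lemma const (k t₀ : ℝ) : HasTwoJetAt (fun _ => k) k 0 0 t₀ :=
  ⟨rfl, fun _ => 0, .of_forall fun t => hasDerivAt_const t k, rfl, hasDerivAt_const _ _⟩

lemma affine (k l : ℝ) : HasTwoJetAt (fun t => k + t * l) k l 0 0 :=
  ⟨by simp, fun _ => l, .of_forall fun t => by
    simpa using ((hasDerivAt_id t).mul_const l).const_add k, rfl, hasDerivAt_const _ _⟩

lemma hasDerivAt (hg : HasTwoJetAt g a b c t₀) : HasDerivAt g b t₀ := by
  obtain ⟨-, g', h₁, rfl, -⟩ := hg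
  exact h₁.self_of_nhds

lemma congr (hg : HasTwoJetAt g a b c t₀) (hgh : g =ᶠ[𝓝 t₀] h) : HasTwoJetAt h a b c t₀ := by
  obtain ⟨h₀, g', h₁, h₂, h₃⟩ := hg
  refine ⟨hgh.eq_of_nhds ▸ h₀, g', ?_, h₂, h₃⟩
  filter_upwards [h₁, eventually_eventually_nhds.2 hgh] with t ht ht'
  exact ht.congr_of_eventuallyEq (ht'.mono fun _ hy => hy.symm)

lemma unique (hg : HasTwoJetAt g a b c t₀) (hg' : HasTwoJetAt g a' b' c' t₀) :
    a = a' ∧ b = b' ∧ c = c' := by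
  obtain ⟨h₀, g₁, h₁, h₂, h₃⟩ := hg
  obtain ⟨k₀, g₂, k₁, k₂, k₃⟩ := hg'
  have he : g₁ =ᶠ[𝓝 t₀] g₂ := by
    filter_upwards [h₁, k₁] with t ht kt using ht.unique kt
  refine ⟨h₀ ▸ k₀, h₂ ▸ k₂ ▸ he.eq_of_nhds, ?_⟩
  exact h₃.unique (k₃.congr_of_eventuallyEq he)

lemma add (hg : HasTwoJetAt g a b c t₀) (hh : HasTwoJetAt h a' b' c' t₀) :
    HasTwoJetAt (fun t => g t + h t) (a + a') (b + b') (c + c') t₀ := by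
  obtain ⟨rfl, g', h₁, rfl, h₃⟩ := hg
  obtain ⟨rfl, k', k₁, rfl, k₃⟩ := hh
  refine ⟨rfl, fun t => g' t + k' t, ?_, rfl, h₃.add k₃⟩
  filter_upwards [h₁, k₁] with t ht kt using ht.add kt

lemma mul (hg : HasTwoJetAt g a b c t₀) (hh : HasTwoJetAt h a' b' c' t₀) :
    HasTwoJetAt (fun t => g t * h t) (a * a') (b * a' + a * b')
      (c * a' + 2 * b * b' + a * c') t₀ := by
  have hg₀ := hg.hasDerivAt
  have hh₀ := hh.hasDerivAt
  obtain ⟨rfl, g', h₁, rfl, h₃⟩ := hg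
  obtain ⟨rfl, k', k₁, rfl, k₃⟩ := hh
  refine ⟨rfl, fun t => g' t * h t + g t * k' t, ?_, rfl, ?_⟩
  · filter_upwards [h₁, k₁] with t ht kt using ht.mul kt
  · exact ((h₃.mul hh₀).add (hg₀.mul k₃)).congr_deriv (by ring)

lemma const_mul (k : ℝ) (hg : HasTwoJetAt g a b c t₀) :
    HasTwoJetAt (fun t => k * g t) (k * a) (k * b) (k * c) t₀ := by
  simpa using (const k t₀).mul hg

lemma sub (hg : HasTwoJetAt g a b c t₀) (hh : HasTwoJetAt h a' b' c' t₀) :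
    HasTwoJetAt (fun t => g t - h t) (a - a') (b - b') (c - c') t₀ := by
  simpa [← sub_eq_add_neg] using hg.add (hh.const_mul (-1))

lemma sq (hg : HasTwoJetAt g a b c t₀) :
    HasTwoJetAt (fun t => g t ^ 2) (a ^ 2) (2 * a * b) (2 * (b ^ 2 + a * c)) t₀ := by
  have := hg.mul hg
  simp only [← _root_.sq] at this
  convert this using 1 <;> ring

lemma log (hg : HasTwoJetAt g a b c t₀) (ha : a ≠ 0) :
    HasTwoJetAt (fun t => Real.log (g t)) (Real.log a) (b / a) (c / a - (b / a) ^ 2) t₀ := by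
  have hg₀ := hg.hasDerivAt
  obtain ⟨rfl, g', h₁, rfl, h₃⟩ := hg
  refine ⟨rfl, fun t => g' t / g t, ?_, rfl, ?_⟩
  · filter_upwards [h₁, hg₀.continuousAt.eventually_ne ha] with t ht hne using ht.log hne
  · exact (h₃.div hg₀ ha).congr_deriv (by field_simp)

lemma of_isLocalMax (hg : HasTwoJetAt g a b c t₀) (hmax : IsLocalMax g t₀) : b = 0 ∧ c ≤ 0 := by
  have hb : b = 0 := hmax.hasDerivAt_eq_zero hg.hasDerivAt
  refine ⟨hb, ?_⟩
  by_contra! hc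
  obtain ⟨-, g', h₁, -, h₃⟩ := id hg
  have hd : deriv g =ᶠ[𝓝 t₀] g' := h₁.mono fun t ht => ht.deriv
  have hdd : deriv (deriv g) t₀ = c := hd.deriv_eq.trans h₃.deriv
  have hmin : IsLocalMin g t₀ := isLocalMin_of_deriv_deriv_pos (by rwa [hdd])
    (by rw [hg.hasDerivAt.deriv, hb]) hg.hasDerivAt.continuousAt
  have heq : g =ᶠ[𝓝 t₀] fun _ => g t₀ := by
    filter_upwards [hmax, hmin] with t h₁ h₂ using le_antisymm h₁ h₂
  exact hc.ne' (hg.unique ((const (g t₀) t₀).congr heq.symm)).2.2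

end HasTwoJetAt

section DirectionalDerivative

variable {V : Type*} [NormedAddCommGroup V] [NormedSpace ℝ V] {s : Set V} {g h : V → ℝ} {x : V}

/-- The derivative of `g` at `x` in the direction `v`. The two-step Fréchet derivative is iterated
through it, so that derivatives of order three and four keep a readable form. -/
noncomputable def dirDeriv (v : V) (g : V → ℝ) (x : V) : ℝ := fderiv ℝ g x v

lemma dirDeriv_congr (hgh : g =ᶠ[𝓝 x] h) (v : V) : dirDeriv v g x = dirDeriv v h x :=
  DFunLike.congr_fun hgh.fderiv_eq v

lemma contDiffAt_dirDeriv {n m : WithTop ℕ∞} (hg : ContDiffAt ℝ n g x) (hmn : m + 1 ≤ n) (v : V) :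
    ContDiffAt ℝ m (dirDeriv v g) x :=
  (hg.fderiv_right hmn).clm_apply contDiffAt_const

lemma dirDeriv_dirDeriv (hg : ContDiffAt ℝ 2 g x) (v w : V) :
    dirDeriv v (dirDeriv w g) x = fderiv ℝ (fderiv ℝ g) x v w := by
  have hd : DifferentiableAt ℝ (fderiv ℝ g) x :=
    (hg.fderiv_right (m := 1) (by norm_num)).differentiableAt one_ne_zero
  have h := hd.hasFDerivAt.clm_apply (hasFDerivAt_const w x)
  change fderiv ℝ (fun y => fderiv ℝ g y w) x v = _
  rw [h.fderiv]
  simp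

lemma dirDeriv_comm (hg : ContDiffAt ℝ 2 g x) (v w : V) :
    dirDeriv v (dirDeriv w g) x = dirDeriv w (dirDeriv v g) x := by
  rw [dirDeriv_dirDeriv hg, dirDeriv_dirDeriv hg]
  exact (hg.isSymmSndFDerivAt (by simp)).eq v w

lemma dirDeriv_comm_eventuallyEq (hg : ContDiffAt ℝ 2 g x) (v w : V) :
    dirDeriv v (dirDeriv w g) =ᶠ[𝓝 x] dirDeriv w (dirDeriv v g) :=
  (hg.eventually (by norm_num)).mono fun _ hy => dirDeriv_comm hy v w

lemma dirDeriv_dirDeriv_lin (hg : ContDiffAt ℝ 2 g x) (v w : V) (α β : ℝ) :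
    dirDeriv (α • v + β • w) (dirDeriv (α • v + β • w) g) x =
      dirDeriv v (dirDeriv v g) x * α ^ 2 + 2 * dirDeriv v (dirDeriv w g) x * (α * β)
        + dirDeriv w (dirDeriv w g) x * β ^ 2 := by
  have hsymm := dirDeriv_comm hg w v
  simp only [dirDeriv_dirDeriv hg] at hsymm ⊢
  simp only [map_add, map_smul, add_apply, smul_apply, smul_eq_mul, hsymm]
  ring

lemma tendsto_add_smul_nhds (x v : V) : Tendsto (fun t : ℝ => x + t • v) (𝓝 0) (𝓝 x) := by
  have hc : ContinuousAt (fun t : ℝ => x + t • v) 0 := by fun_prop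
  simpa [ContinuousAt] using hc

lemma hasTwoJetAt_line (hg : ContDiffAt ℝ 2 g x) (v : V) :
    HasTwoJetAt (fun t : ℝ => g (x + t • v)) (g x) (dirDeriv v g x)
      (dirDeriv v (dirDeriv v g) x) 0 := by
  have key (k : V → ℝ) (t : ℝ) (hk : ContDiffAt ℝ 1 k (x + t • v)) :
      HasDerivAt (fun t : ℝ => k (x + t • v)) (dirDeriv v k (x + t • v)) t :=
    (hk.differentiableAt one_ne_zero).hasFDerivAt.comp_hasDerivAt t
      (by simpa using ((hasDerivAt_id t).smul_const v).const_add x)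
  refine ⟨by simp, fun t => dirDeriv v g (x + t • v), ?_, by simp, ?_⟩
  · filter_upwards [(tendsto_add_smul_nhds x v).eventually (hg.eventually (by norm_num))]
      with t ht using key g t (ht.of_le (by norm_num))
  · simpa using key (dirDeriv v g) 0
      (by simpa using contDiffAt_dirDeriv hg (by norm_num) v)

lemma isLocalMax_line (hg : IsLocalMax g x) (v : V) :
    IsLocalMax (fun t : ℝ => g (x + t • v)) 0 := by
  filter_upwards [(tendsto_add_smul_nhds x v).eventually hg] with t ht
  simpa using ht

lemma dirDeriv_dirDeriv_nonneg (hconv : ConvexOn ℝ s g) (hs : s ∈ 𝓝 x) (hg : ContDiffAt ℝ 2 g x)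
    (v : V) : 0 ≤ dirDeriv v (dirDeriv v g) x := by
  have hv := hasTwoJetAt_line hg v
  have hv' := hasTwoJetAt_line hg (-v)
  have hneg : dirDeriv (-v) (dirDeriv (-v) g) x = dirDeriv v (dirDeriv v g) x := by
    simp only [dirDeriv_dirDeriv hg, map_neg, neg_apply, neg_neg]
  have hmax : IsLocalMax (fun t : ℝ => -1 * (g (x + t • v) + g (x + t • -v))) 0 := by
    filter_upwards [(tendsto_add_smul_nhds x v).eventually hs,
      (tendsto_add_smul_nhds x (-v)).eventually hs] with t ht ht'
    have hmid := hconv.2 ht ht' (by norm_num : (0 : ℝ) ≤ 1 / 2) (by norm_num : (0 : ℝ) ≤ 1 / 2)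
      (by norm_num)
    rw [show (1 / 2 : ℝ) • (x + t • v) + (1 / 2 : ℝ) • (x + t • -v) = x by module] at hmid
    simp only [smul_eq_mul, zero_smul, add_zero] at hmid ⊢
    linarith
  have := (((hv.add hv').const_mul (-1)).of_isLocalMax hmax).2
  rw [hneg] at this
  linarith

lemma add_fderiv_le_of_convexOn (hconv : ConvexOn ℝ s g) {y : V} (hx : x ∈ s) (hy : y ∈ s)
    (hg : DifferentiableAt ℝ g x) : g x + fderiv ℝ g x (y - x) ≤ g y := by
  have hline : ConvexOn ℝ (AffineMap.lineMap x y ⁻¹' s) (g ∘ AffineMap.lineMap (k := ℝ) x y) :=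
    hconv.comp_affineMap _
  have hderiv : HasDerivAt (g ∘ AffineMap.lineMap (k := ℝ) x y) (fderiv ℝ g x (y - x)) 0 :=
    HasFDerivAt.comp_hasDerivAt (0 : ℝ) (by simpa using hg.hasFDerivAt) AffineMap.hasDerivAt_lineMap
  have := hline.le_slope_of_hasDerivAt (x := 0) (y := 1) (by simpa) (by simpa) one_pos hderiv
  simp only [slope_def_field, Function.comp_apply, AffineMap.lineMap_apply_one,
    AffineMap.lineMap_apply_zero, sub_zero, div_one] at this
  linarith

end DirectionalDerivative

section HessianDeterminant

variable {V ι : Type*} [NormedAddCommGroup V] [InnerProductSpace ℝ V] [Fintype ι] [DecidableEq ι]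
  {s : Set V} {u : V → ℝ} {x : V}

/-- The determinant of the Hessian of `u` at `x`, computed in an orthonormal basis. -/
noncomputable def hessDet (b : OrthonormalBasis ι ℝ V) (u : V → ℝ) (x : V) : ℝ :=
  (Matrix.of fun i j => fderiv ℝ (fderiv ℝ u) x (b i) (b j)).det

lemma hessDet_eq_hessDet (b b' : OrthonormalBasis ι ℝ V) (u : V → ℝ) (x : V) :
    hessDet b u x = hessDet b' u x := by
  let B := (fderiv ℝ (fderiv ℝ u) x).toBilinForm
  have hdet : (b.toBasis.toMatrix b'.toBasis).det * (b.toBasis.toMatrix b'.toBasis).det = 1 := by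
    obtain h | h := b.det_to_matrix_orthonormalBasis_real b' <;>
      simp [Module.Basis.det_apply] at h <;> simp [h]
  have hB := LinearMap.BilinForm.toMatrix_mul_basis_toMatrix b.toBasis b'.toBasis B
  have hB' := congrArg Matrix.det hB
  rw [Matrix.det_mul, Matrix.det_mul, Matrix.det_transpose] at hB'
  have key (c : OrthonormalBasis ι ℝ V) :
      hessDet c u x = (LinearMap.BilinForm.toMatrix c.toBasis B).det := by
    rw [hessDet]
    congr 1
    ext i j
    simp [B, LinearMap.BilinForm.toMatrix_apply]
  rw [key, key, ← hB']
  linear_combination (-(LinearMap.BilinForm.toMatrix b.toBasis B).det) * hdet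

lemma hessDet_eq_mul_sub_sq (b : OrthonormalBasis (Fin 2) ℝ V) (hu : ContDiffAt ℝ 2 u x) :
    hessDet b u x = dirDeriv (b 0) (dirDeriv (b 0) u) x * dirDeriv (b 1) (dirDeriv (b 1) u) x
      - dirDeriv (b 0) (dirDeriv (b 1) u) x ^ 2 := by
  have hsymm := dirDeriv_comm hu (b 1) (b 0)
  simp only [dirDeriv_dirDeriv hu] at hsymm ⊢
  rw [hessDet, Matrix.det_fin_two]
  simp only [Matrix.of_apply, hsymm, sq]

end HessianDeterminant

section ComparisonPrinciple

lemma sq_le_mul_of_quadratic_nonneg {P Q T : ℝ}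
    (h : ∀ α β : ℝ, 0 ≤ P * α ^ 2 + 2 * Q * (α * β) + T * β ^ 2) :
    0 ≤ P ∧ 0 ≤ T ∧ Q ^ 2 ≤ P * T := by
  have hP : 0 ≤ P := by simpa using h 1 0
  have hT : 0 ≤ T := by simpa using h 0 1
  have hdisc := discrim_le_zero (a := P) (b := 2 * Q) (c := T) fun α => by linarith [h α 1]
  refine ⟨hP, hT, ?_⟩
  rw [discrim] at hdisc
  linarith

lemma mul_sub_sq_le_mul_sub_sq {P Q T P' Q' T' : ℝ}
    (h₀ : ∀ α β : ℝ, 0 ≤ P * α ^ 2 + 2 * Q * (α * β) + T * β ^ 2)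
    (h : ∀ α β : ℝ, P * α ^ 2 + 2 * Q * (α * β) + T * β ^ 2
      ≤ P' * α ^ 2 + 2 * Q' * (α * β) + T' * β ^ 2) :
    P * T - Q ^ 2 ≤ P' * T' - Q' ^ 2 := by
  obtain ⟨hP, hT, hQ⟩ := sq_le_mul_of_quadratic_nonneg h₀
  obtain ⟨hp, ht, hq⟩ := sq_le_mul_of_quadratic_nonneg (P := P' - P) (Q := Q' - Q) (T := T' - T)
    fun α β => by linarith [h α β]
  -- the mixed discriminant of two nonnegative forms dominates their mixed term
  have hmixed : 2 * Q * (Q' - Q) ≤ P * (T' - T) + (P' - P) * T := by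
    refine le_of_sq_le_sq ?_ (by positivity)
    nlinarith [mul_le_mul hQ hq (sq_nonneg _) (mul_nonneg hP hT),
      sq_nonneg (P * (T' - T) - (P' - P) * T)]
  linarith

variable {V : Type*} [NormedAddCommGroup V] [InnerProductSpace ℝ V] {s K : Set V}
  {u g : V → ℝ} {x : V}

lemma hessDet_le_of_isLocalMax_sub (b : OrthonormalBasis (Fin 2) ℝ V) (hconv : ConvexOn ℝ s u)
    (hs : s ∈ 𝓝 x) (hu : ContDiffAt ℝ 2 u x) (hmax : IsLocalMax (fun y => u y - g y) x)
    {P Q T : ℝ}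
    (hg : ∀ α β : ℝ, ∃ l, HasTwoJetAt (fun t : ℝ => g (x + t • (α • b 0 + β • b 1))) (g x) l
      (P * α ^ 2 + 2 * Q * (α * β) + T * β ^ 2) 0) :
    hessDet b u x ≤ P * T - Q ^ 2 := by
  rw [hessDet_eq_mul_sub_sq b hu]
  refine mul_sub_sq_le_mul_sub_sq (fun α β => ?_) fun α β => ?_
  · rw [← dirDeriv_dirDeriv_lin hu]
    exact dirDeriv_dirDeriv_nonneg hconv hs hu _
  · obtain ⟨l, hl⟩ := hg α β
    rw [← dirDeriv_dirDeriv_lin hu, ← sub_nonpos]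
    exact (((hasTwoJetAt_line hu _).sub hl).of_isLocalMax (isLocalMax_line hmax _)).2

lemma le_of_hessDet_lt (b : OrthonormalBasis (Fin 2) ℝ V) (hconv : ConvexOn ℝ s u)
    (hK : IsCompact K) (hs : s ∈ 𝓝ˢ K) (hu : ∀ x ∈ K, ContDiffAt ℝ 2 u x) (hg : ContinuousOn g K)
    (hlt : ∀ x ∈ K, g x < u x → K ∈ 𝓝 x ∧ ∃ P Q T : ℝ, P * T - Q ^ 2 < hessDet b u x ∧
      ∀ α β : ℝ, ∃ l, HasTwoJetAt (fun t : ℝ => g (x + t • (α • b 0 + β • b 1))) (g x) l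
        (P * α ^ 2 + 2 * Q * (α * β) + T * β ^ 2) 0) :
    ∀ x ∈ K, u x ≤ g x := by
  by_contra! ⟨y, hyK, hy⟩
  have hcont : ContinuousOn (fun x => u x - g x) K :=
    .sub (fun x hx => (hu x hx).continuousAt.continuousWithinAt) hg
  obtain ⟨x, hxK, hx⟩ := hK.exists_isMaxOn ⟨y, hyK⟩ hcont
  have hxy : u y - g y ≤ u x - g x := hx hyK
  obtain ⟨hKx, P, Q, T, hdet, hjet⟩ := hlt x hxK (by linarith)
  exact hdet.not_ge (hessDet_le_of_isLocalMax_sub b hconv (mem_nhdsSet_iff_forall.1 hs x hxK)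
    (hu x hxK) (hx.isLocalMax hKx) hjet)

end ComparisonPrinciple

section StrictConvexity

variable {V : Type*} [NormedAddCommGroup V] [InnerProductSpace ℝ V] {s : Set V} {u : V → ℝ}
  {b : OrthonormalBasis (Fin 2) ℝ V} {r h L δ a κ : ℝ} {x : V}

/-- The closed rectangle `[0, r] × [0, h]` in the coordinates of the orthonormal basis `b`. -/
def coordRect (b : OrthonormalBasis (Fin 2) ℝ V) (r h : ℝ) : Set V :=
  {x | ⟪b 0, x⟫ ∈ Set.Icc 0 r ∧ ⟪b 1, x⟫ ∈ Set.Icc 0 h}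

lemma norm_sq_eq_inner_sq_add_inner_sq (b : OrthonormalBasis (Fin 2) ℝ V) (x : V) :
    ‖x‖ ^ 2 = ⟪b 0, x⟫ ^ 2 + ⟪b 1, x⟫ ^ 2 := by
  simpa using (b.sum_sq_norm_inner_right x).symm

lemma isCompact_coordRect (b : OrthonormalBasis (Fin 2) ℝ V) (r h : ℝ) :
    IsCompact (coordRect b r h) := by
  have : FiniteDimensional ℝ V := b.toBasis.finiteDimensional_of_finite
  have : ProperSpace V := FiniteDimensional.proper_real V
  refine isCompact_of_isClosed_isBounded ?_ ?_
  · exact (isClosed_Icc.preimage (by fun_prop)).inter (isClosed_Icc.preimage (by fun_prop))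
  · refine (isBounded_iff_forall_norm_le).2 ⟨√(r ^ 2 + h ^ 2), fun x ⟨h₀, h₁⟩ => ?_⟩
    refine Real.le_sqrt_of_sq_le ?_
    rw [norm_sq_eq_inner_sq_add_inner_sq b]
    gcongr
    exacts [h₀.1, h₀.2, h₁.1, h₁.2]

lemma coordRect_mem_nhds (h₀ : ⟪b 0, x⟫ ∈ Set.Ioo 0 r) (h₁ : ⟪b 1, x⟫ ∈ Set.Ioo 0 h) :
    coordRect b r h ∈ 𝓝 x := by
  have hc (i : Fin 2) : ContinuousAt (fun y : V => ⟪b i, y⟫) x := by fun_prop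
  filter_upwards [hc 0 (Icc_mem_nhds h₀.1 h₀.2), hc 1 (Icc_mem_nhds h₁.1 h₁.2)] with y hy₀ hy₁
  exact ⟨hy₀, hy₁⟩

lemma smul_mem_coordRect {t : ℝ} (ht : t ∈ Set.Icc 0 r) (hh : 0 ≤ h) :
    t • b 0 ∈ coordRect b r h := by
  simpa [coordRect, inner_smul_right, b.inner_eq_ite] using ⟨ht, hh⟩

lemma sub_tangent_le_of_mem_coordRect (hconv : ConvexOn ℝ s u)
    (hdiff : ∀ x ∈ s, DifferentiableAt ℝ u x) (hL : ∀ x ∈ s, ‖fderiv ℝ u x‖ ≤ L) (hr : 0 < r)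
    (hs : coordRect b r h ⊆ s) (hδ : u (r • b 0) - u 0 - fderiv ℝ u 0 (r • b 0) ≤ δ)
    (hδ₀ : 0 ≤ δ) (hx : x ∈ coordRect b r h) :
    u x - u 0 - fderiv ℝ u 0 x ≤ δ + 2 * L * ⟪b 1, x⟫ := by
  obtain ⟨hx₀, hx₁⟩ := id hx
  set t := ⟪b 0, x⟫
  have hmem {τ : ℝ} (hτ : τ ∈ Set.Icc 0 r) : τ • b 0 ∈ s :=
    hs (smul_mem_coordRect hτ (hx₁.1.trans hx₁.2))
  have h0 : (0 : V) ∈ s := by simpa using hmem ⟨le_rfl, hr.le⟩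
  have hedge : u (t • b 0) - u 0 - fderiv ℝ u 0 (t • b 0) ≤ δ := by
    have hle := hconv.2 h0 (hmem ⟨hr.le, le_rfl⟩)
      (sub_nonneg.2 (div_le_one_of_le₀ hx₀.2 hr.le)) (div_nonneg hx₀.1 hr.le) (by ring)
    simp only [smul_zero, zero_add, smul_smul, div_mul_cancel₀ t hr.ne', smul_eq_mul] at hle
    simp only [map_smul, smul_eq_mul] at hδ ⊢
    have hscaled := mul_le_mul_of_nonneg_left hδ (div_nonneg hx₀.1 hr.le)
    have hle_one := mul_le_of_le_one_left hδ₀ (div_le_one_of_le₀ hx₀.2 hr.le)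
    have hcancel : t / r * (r * fderiv ℝ u 0 (b 0)) = t * fderiv ℝ u 0 (b 0) := by field_simp
    linarith
  have hx_eq : x - t • b 0 = ⟪b 1, x⟫ • b 1 := by
    rw [sub_eq_iff_eq_add', ← Fin.sum_univ_two (fun i => ⟪b i, x⟫ • b i), b.sum_repr' x]
  have hmv := hconv.1.norm_image_sub_le_of_norm_fderiv_le' (φ := fderiv ℝ u 0) (C := 2 * L) hdiff
    (fun y hy => (norm_sub_le _ _).trans (by linarith [hL y hy, hL 0 h0])) (hmem hx₀) (hs hx)
  rw [map_sub] at hmv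
  have hnorm : ‖x - t • b 0‖ = ⟪b 1, x⟫ := by
    rw [hx_eq, norm_smul, b.norm_eq_one, mul_one, Real.norm_of_nonneg hx₁.1]
  rw [hnorm] at hmv
  linarith [Real.le_norm_self (u x - u (t • b 0) - (fderiv ℝ u 0 x - fderiv ℝ u 0 (t • b 0)))]

/-- A barrier on the rectangle `[0, r] × [0, r - δ]`. Its Hessian determinant
`2 a κ - (2 a (⟪b 0, x⟫ - r / 2)) ^ 2` is small, although it is large on three sides of the
rectangle and dips below `0` near the fourth side `⟪b 1, x⟫ = 0`. -/
noncomputable def edgeBarrier (b : OrthonormalBasis (Fin 2) ℝ V) (r δ a κ : ℝ) (x : V) : ℝ :=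
  (⟪b 1, x⟫ + δ) *
    (a * (⟪b 0, x⟫ - r / 2) ^ 2 + κ * (Real.log (⟪b 1, x⟫ + δ) - Real.log δ) - 2) + 3 * δ

lemma hasTwoJetAt_clm_line (ℓ : V →L[ℝ] ℝ) (k : ℝ) (x v : V) :
    HasTwoJetAt (fun t : ℝ => ℓ (x + t • v) + k) (ℓ x + k) (ℓ v) 0 0 := by
  convert HasTwoJetAt.affine (ℓ x + k) (ℓ v) using 2 with t
  simp
  ring

lemma exists_hasTwoJetAt_edgeBarrier (hx : ⟪b 1, x⟫ + δ ≠ 0) (α β : ℝ) :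
    ∃ l, HasTwoJetAt (fun t : ℝ => edgeBarrier b r δ a κ (x + t • (α • b 0 + β • b 1)))
      (edgeBarrier b r δ a κ x) l
      (2 * a * (⟪b 1, x⟫ + δ) * α ^ 2 + 2 * (2 * a * (⟪b 0, x⟫ - r / 2)) * (α * β)
        + κ / (⟪b 1, x⟫ + δ) * β ^ 2) 0 := by
  have hcoord (i : Fin 2) (k : ℝ) :
      HasTwoJetAt (fun t : ℝ => ⟪b i, x + t • (α • b 0 + β • b 1)⟫ + k) (⟪b i, x⟫ + k)
        (![α, β] i) 0 0 := by
    have h := hasTwoJetAt_clm_line (innerSL ℝ (b i)) k x (α • b 0 + β • b 1)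
    fin_cases i <;> simpa [inner_add_right, inner_smul_right, b.inner_eq_ite] using h
  have hS := hcoord 1 δ
  have h := (hS.mul ((((hcoord 0 (-(r / 2))).sq.const_mul a).add
    (((hS.log hx).sub (.const (Real.log δ) 0)).const_mul κ)).sub (.const 2 0))).add
    (.const (3 * δ) 0)
  simp only [← sub_eq_add_neg] at h
  unfold edgeBarrier
  convert (⟨_, h⟩ : ∃ l, HasTwoJetAt _ _ l _ 0) using 3
  simp
  field_simp
  ring

lemma le_edgeBarrier_of_notMem_nhds (hδ : 0 < δ) (hL : 0 ≤ L) (ha : 0 ≤ a) (hκ : 0 ≤ κ)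
    (hside : 2 * L + 2 ≤ a * (r / 2) ^ 2)
    (htop : 2 * L + 2 ≤ κ * (Real.log r - Real.log δ)) (hx : x ∈ coordRect b r (r - δ))
    (hfrontier : coordRect b r (r - δ) ∉ 𝓝 x) :
    δ + 2 * L * ⟪b 1, x⟫ ≤ edgeBarrier b r δ a κ x := by
  obtain ⟨⟨hx₀, hx₀'⟩, hx₁, hx₁'⟩ := id hx
  have hlog : 0 ≤ κ * (Real.log (⟪b 1, x⟫ + δ) - Real.log δ) :=
    mul_nonneg hκ (sub_nonneg.2 (Real.log_le_log hδ (by linarith)))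
  have hy : 0 ≤ a * (⟪b 0, x⟫ - r / 2) ^ 2 := by positivity
  have hedge : ⟪b 1, x⟫ = 0 ∨ 2 * L + 2 ≤ a * (⟪b 0, x⟫ - r / 2) ^ 2 ∨
      2 * L + 2 ≤ κ * (Real.log (⟪b 1, x⟫ + δ) - Real.log δ) := by
    by_contra! ⟨hbot', hside', htop'⟩
    refine hfrontier (coordRect_mem_nhds ⟨hx₀.lt_of_ne ?_, hx₀'.lt_of_ne ?_⟩
      ⟨hx₁.lt_of_ne hbot'.symm, hx₁'.lt_of_ne ?_⟩) <;> intro heq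
    · rw [← heq] at hside'
      linarith
    · rw [heq] at hside'
      linarith
    · rw [heq, sub_add_cancel] at htop'
      linarith
  unfold edgeBarrier
  rcases hedge with h | h | h
  · simp only [h, zero_add, sub_self, mul_zero, add_zero]
    nlinarith
  all_goals nlinarith [mul_nonneg hL hδ.le]

lemma sub_tangent_le_edgeBarrier {m : ℝ} (hsub : coordRect b r (r - δ) ⊆ s) (hs : IsOpen s)
    (hconv : ConvexOn ℝ s u) (hu : ContDiffOn ℝ 2 u s) (hL : ∀ x ∈ s, ‖fderiv ℝ u x‖ ≤ L)
    (hdet : ∀ x ∈ s, m ≤ hessDet b u x) (hδ : 0 < δ) (hδr : δ < r) (ha : 0 ≤ a) (hκ : 0 ≤ κ)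
    (hside : 2 * L + 2 ≤ a * (r / 2) ^ 2)
    (htop : 2 * L + 2 ≤ κ * (Real.log r - Real.log δ)) (hm : 2 * a * κ < m)
    (hgap : u (r • b 0) - u 0 - fderiv ℝ u 0 (r • b 0) ≤ δ) :
    ∀ x ∈ coordRect b r (r - δ), u x ≤ fderiv ℝ u 0 x + u 0 + edgeBarrier b r δ a κ x := by
  have hcd {x : V} (hx : x ∈ s) : ContDiffAt ℝ 2 u x := hu.contDiffAt (hs.mem_nhds hx)
  have hpos {x : V} (hx : x ∈ coordRect b r (r - δ)) : 0 < ⟪b 1, x⟫ + δ := by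
    linarith [hx.2.1]
  refine le_of_hessDet_lt b hconv (isCompact_coordRect b r _) (hs.mem_nhdsSet.2 hsub)
    (fun x hx => hcd (hsub hx)) ?_ fun x hx hlt => ⟨?_, 2 * a * (⟪b 1, x⟫ + δ),
      2 * a * (⟪b 0, x⟫ - r / 2), κ / (⟪b 1, x⟫ + δ), ?_, fun α β => ?_⟩
  · have hlog : ContinuousOn (fun x : V => Real.log (⟪b 1, x⟫ + δ)) (coordRect b r (r - δ)) :=
      .log (by fun_prop) fun x hx => (hpos hx).ne'
    unfold edgeBarrier
    fun_prop
  · by_contra hfrontier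
    have hle := sub_tangent_le_of_mem_coordRect hconv
      (fun y hy => (hcd hy).differentiableAt two_ne_zero) hL (hδ.trans hδr) hsub hgap hδ.le hx
    have hbar := le_edgeBarrier_of_notMem_nhds hδ ((norm_nonneg _).trans (hL x (hsub hx))) ha hκ
      hside htop hx hfrontier
    linarith
  · refine lt_of_lt_of_le ?_ (hdet x (hsub hx))
    have hcancel : 2 * a * (⟪b 1, x⟫ + δ) * (κ / (⟪b 1, x⟫ + δ)) = 2 * a * κ := by
      field_simp [(hpos hx).ne']
    nlinarith [sq_nonneg (2 * a * (⟪b 0, x⟫ - r / 2))]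
  · obtain ⟨l, hl⟩ := exists_hasTwoJetAt_edgeBarrier (b := b) (r := r) (a := a) (κ := κ)
      (hpos hx).ne' α β
    have h := (hasTwoJetAt_clm_line (fderiv ℝ u 0) (u 0) x (α • b 0 + β • b 1)).add hl
    rw [zero_add] at h
    exact ⟨_, h⟩

lemma exists_orthonormalBasis_apply_zero_eq (b : OrthonormalBasis (Fin 2) ℝ V) {ξ : V}
    (hξ : ‖ξ‖ = 1) : ∃ b' : OrthonormalBasis (Fin 2) ℝ V, b' 0 = ξ := by
  have : FiniteDimensional ℝ V := b.toBasis.finiteDimensional_of_finite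
  obtain ⟨b', hb'⟩ := Orthonormal.exists_orthonormalBasis_extension_of_card_eq (𝕜 := ℝ) (E := V)
    (Module.finrank_eq_card_basis b.toBasis) (v := fun _ : Fin 2 => ξ) (s := {0})
    (orthonormal_subsingleton_iff.2 fun _ => hξ)
  exact ⟨b', hb' 0 rfl⟩

lemma lt_sub_tangent_of_norm_eq {m R : ℝ} (hconv : ConvexOn ℝ (ball 0 R) u)
    (hu : ContDiffOn ℝ 2 u (ball 0 R)) (hL : ∀ x ∈ ball 0 R, ‖fderiv ℝ u x‖ ≤ L)
    (hdet : ∀ x ∈ ball 0 R, m ≤ hessDet b u x) (hδ : 0 < δ) (hδR : 4 * δ ≤ R)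
    (ha : 0 ≤ a) (hκ : 0 ≤ κ) (hκ' : κ ≤ 1 / 2) (hside : 2 * L + 2 ≤ a * (R / 4) ^ 2)
    (htop : 2 * L + 2 ≤ κ * (Real.log (R / 2) - Real.log δ)) (hm : 2 * a * κ < m)
    (hx : ‖x‖ = R / 2) : δ < u x - u 0 - fderiv ℝ u 0 x := by
  have hR : 0 < R := by linarith
  obtain ⟨b', hb'⟩ := exists_orthonormalBasis_apply_zero_eq b (ξ := (R / 2)⁻¹ • x)
    (by rw [norm_smul, hx, norm_inv, Real.norm_of_nonneg (by positivity)]; field_simp)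
  have hxb : x = (R / 2) • b' 0 := by rw [hb', smul_inv_smul₀ (by positivity)]
  have hsub : coordRect b' (R / 2) (R / 2 - δ) ⊆ ball 0 R := fun y hy => by
    rw [mem_ball_zero_iff]
    refine lt_of_pow_lt_pow_left₀ 2 hR.le ?_
    rw [norm_sq_eq_inner_sq_add_inner_sq b']
    nlinarith [hy.1.1, hy.1.2, hy.2.1, hy.2.2]
  by_contra! hgap
  rw [hxb] at hgap
  have hbar := sub_tangent_le_edgeBarrier hsub isOpen_ball hconv hu hL
    (fun y hy => hessDet_eq_hessDet b' b u y ▸ hdet y hy) hδ (by linarith) ha hκ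
    (by linarith [show R / 2 / 2 = R / 4 by ring]) htop hm hgap
  -- the barrier is negative at `y`, but the convex `u` lies above its tangent plane
  set y := (R / 4) • b' 0 + δ • b' 1 with hy
  have hy₀ : ⟪b' 0, y⟫ = R / 4 := by
    simp [hy, inner_add_right, inner_smul_right, b'.inner_eq_ite]
  have hy₁ : ⟪b' 1, y⟫ = δ := by
    simp [hy, inner_add_right, inner_smul_right, b'.inner_eq_ite]
  have hmem : y ∈ coordRect b' (R / 2) (R / 2 - δ) :=
    ⟨by rw [hy₀]; constructor <;> linarith, by rw [hy₁]; constructor <;> linarith⟩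
  have htangent := add_fderiv_le_of_convexOn hconv (mem_ball_self hR) (hsub hmem)
    ((hu.contDiffAt (ball_mem_nhds 0 hR)).differentiableAt two_ne_zero)
  have hle := hbar y hmem
  have hlog : Real.log (δ + δ) - Real.log δ = Real.log 2 := by
    rw [← two_mul, Real.log_mul two_ne_zero hδ.ne', add_sub_cancel_right]
  rw [edgeBarrier, hy₀, hy₁, hlog] at hle
  rw [sub_zero] at htangent
  have hκlog : κ * Real.log 2 < 1 / 2 := by
    nlinarith [Real.log_two_lt_d9, Real.log_nonneg one_le_two]
  nlinarith

theorem exists_pos_lt_sub_tangent {m R : ℝ} (hm : 0 < m) (hR : 0 < R) (hL : 0 ≤ L)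
    (b : OrthonormalBasis (Fin 2) ℝ V) :
    ∃ δ : ℝ, 0 < δ ∧ ∀ u : V → ℝ, ContDiffOn ℝ 2 u (ball 0 R) → ConvexOn ℝ (ball 0 R) u →
      (∀ x ∈ ball 0 R, ‖fderiv ℝ u x‖ ≤ L) → (∀ x ∈ ball 0 R, m ≤ hessDet b u x) →
      ∀ x, ‖x‖ = R / 2 → δ < u x - u 0 - fderiv ℝ u 0 x := by
  set a := (2 * L + 2) / (R / 4) ^ 2 + m
  have ha : m ≤ a := le_add_of_nonneg_left (by positivity)
  set κ := m / (4 * a)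
  have ha₀ : 0 < a := hm.trans_le ha
  have hκ : 0 < κ := by positivity
  set c := (2 * L + 2) / κ
  have hc : 0 < c := by positivity
  have hexp : 2 ≤ Real.exp (c + 1) := by linarith [Real.add_one_le_exp (c + 1)]
  refine ⟨R / 2 / Real.exp (c + 1), by positivity, fun u hu hconv hLu hdet x hx =>
    lt_sub_tangent_of_norm_eq (a := a) (κ := κ) hconv hu hLu hdet (by positivity) ?_ ha₀.le
      hκ.le ?_ ?_ ?_ ?_ hx⟩
  · rw [← mul_div_assoc, div_le_iff₀ (Real.exp_pos _)]
    nlinarith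
  · rw [div_le_iff₀ (by positivity)]
    linarith
  · rw [add_mul, div_mul_cancel₀ _ (by positivity)]
    exact le_add_of_nonneg_right (by positivity)
  · rw [Real.log_div (by positivity) (Real.exp_pos _).ne', Real.log_exp, sub_sub_cancel, mul_add,
      mul_div_cancel₀ _ hκ.ne']
    linarith
  · have : 2 * a * κ = m / 2 := by
      simp only [κ]
      field_simp
      norm_num
    linarith

end StrictConvexity

/-- The derivatives at a point of a solution `u` of the Gauss curvature equation and of the
curvature `f`, in an orthonormal frame diagonalising the Hessian of `u` with eigenvalues `A` and
`D`. The equation is differentiated twice along the first vector of the frame and once along the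
second; `m` and `Λ` bound the data of the problem. -/
structure GaussJet (m Λ : ℝ) where
  (u₁ u₂ A D u₁₁₁ u₁₁₂ u₁₂₂ u₂₂₂ u₁₁₁₁ u₁₁₂₂ f f₁ f₂ f₁₁ : ℝ)
  A_pos : 0 < A
  le_f : m ≤ f
  f_le : f ≤ Λ
  f₁_le : |f₁| ≤ Λ
  f₂_le : |f₂| ≤ Λ
  f₁₁_le : |f₁₁| ≤ Λ
  u₁_le : |u₁| ≤ Λ
  u₂_le : |u₂| ≤ Λ
  eqn : A * D = f * (1 + u₁ ^ 2 + u₂ ^ 2) ^ 2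
  eqn₁ : D * u₁₁₁ + A * u₁₂₂ =
    f₁ * (1 + u₁ ^ 2 + u₂ ^ 2) ^ 2 + 4 * f * (1 + u₁ ^ 2 + u₂ ^ 2) * (u₁ * A)
  eqn₂ : D * u₁₁₂ + A * u₂₂₂ =
    f₂ * (1 + u₁ ^ 2 + u₂ ^ 2) ^ 2 + 4 * f * (1 + u₁ ^ 2 + u₂ ^ 2) * (u₂ * D)
  eqn₁₁ : D * u₁₁₁₁ + A * u₁₁₂₂ + 2 * u₁₁₁ * u₁₂₂ - 2 * u₁₁₂ ^ 2 =
    f₁₁ * (1 + u₁ ^ 2 + u₂ ^ 2) ^ 2 + 8 * f₁ * (1 + u₁ ^ 2 + u₂ ^ 2) * (u₁ * A)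
      + 8 * f * (u₁ * A) ^ 2
      + 4 * f * (1 + u₁ ^ 2 + u₂ ^ 2) * (A ^ 2 + u₁ * u₁₁₁ + u₂ * u₁₁₂)

/-- A `GaussJet` together with the gradient of the weight `w = δ + ℓ - u` (`ℓ` affine), at an
interior maximum of the test function `log u₁₁ + 2 log w + K / 2 * |∇u|²`. -/
structure CriticalJet (K m Λ : ℝ) extends GaussJet m Λ where
  (w w₁ w₂ : ℝ)
  w_pos : 0 < w
  w_le : w ≤ Λ
  w₁_le : |w₁| ≤ Λ
  w₂_le : |w₂| ≤ Λ
  crit₁ : u₁₁₁ / A + 2 * (w₁ / w) + K * (u₁ * A) = 0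
  crit₂ : u₁₁₂ / A + 2 * (w₂ / w) + K * (u₂ * D) = 0
  max₁ : u₁₁₁₁ / A - (u₁₁₁ / A) ^ 2 + 2 * (-A / w - (w₁ / w) ^ 2)
    + K * (A ^ 2 + u₁ * u₁₁₁ + u₂ * u₁₁₂) ≤ 0
  max₂ : u₁₁₂₂ / A - (u₁₁₂ / A) ^ 2 + 2 * (-D / w - (w₂ / w) ^ 2)
    + K * (D ^ 2 + u₁ * u₁₂₂ + u₂ * u₂₂₂) ≤ 0

namespace GaussJet

variable {m Λ : ℝ} (J : GaussJet m Λ)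

/-- The quantity `1 + |∇u|²`. -/
def W : ℝ := 1 + J.u₁ ^ 2 + J.u₂ ^ 2

lemma one_le_W : 1 ≤ J.W := by
  unfold W
  nlinarith [sq_nonneg J.u₁, sq_nonneg J.u₂]

lemma W_le (hΛ : 1 ≤ Λ) : J.W ≤ 3 * Λ ^ 2 := by
  unfold W
  nlinarith [sq_le_sq' (abs_le.1 J.u₁_le).1 (abs_le.1 J.u₁_le).2,
    sq_le_sq' (abs_le.1 J.u₂_le).1 (abs_le.1 J.u₂_le).2]

/-- The right-hand side of the once differentiated equation `eqn₁`. -/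
def φ₁ : ℝ := J.f₁ * J.W ^ 2 + 4 * J.f * J.W * (J.u₁ * J.A)

lemma D_pos (hm : 0 < m) : 0 < J.D := by
  refine pos_of_mul_pos_right (a := J.A) ?_ J.A_pos.le
  rw [J.eqn, ← W]
  have := J.one_le_W
  have := hm.trans_le J.le_f
  positivity

lemma mul_le_pow (hΛ : 1 ≤ Λ) : J.A * J.D ≤ 9 * Λ ^ 5 := by
  have hW := J.one_le_W
  calc J.A * J.D = J.f * J.W ^ 2 := J.eqn
    _ ≤ Λ * (3 * Λ ^ 2) ^ 2 := by gcongr; exacts [J.f_le, J.W_le hΛ]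
    _ = 9 * Λ ^ 5 := by ring

lemma le_mul (hm : 0 < m) : m ≤ J.A * J.D := by
  rw [J.eqn, ← W]
  nlinarith [J.le_f, one_le_pow₀ J.one_le_W (n := 2)]

end GaussJet

namespace CriticalJet

variable {K m Λ : ℝ} (J : CriticalJet K m Λ)

/-- The combination `D * max₁ + A * max₂`, in which the equation eliminates all derivatives of
order four. -/
lemma weighted_max_nonpos (hm : 0 < m) :
    K * (J.A * J.D) * (J.A + J.D) + J.f₁₁ * J.W ^ 2 / J.A + 8 * J.f₁ * J.W * J.u₁
      + (8 * J.f * J.u₁ ^ 2 * J.A + 4 * J.f * J.W * J.A)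
      + (J.D * (J.u₁₁₁ / J.A) ^ 2 - 2 * (J.u₁₁₁ / J.A) * (J.φ₁ / J.A))
      + (J.A * (J.u₁₁₂ / J.A) ^ 2 - 2 * J.A * (J.w₂ / J.w) ^ 2)
      - 4 * (J.A * J.D) / J.w - 2 * J.D * (J.w₁ / J.w) ^ 2
      - 8 * J.f * J.W * (J.u₁ * J.w₁ + J.u₂ * J.w₂) / J.w
      + K * J.W ^ 2 * (J.u₁ * J.f₁ + J.u₂ * J.f₂) ≤ 0 := by
  have hA := J.A_pos.ne'
  obtain ⟨α, hα⟩ : ∃ α, J.u₁₁₁ / J.A = α := ⟨_, rfl⟩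
  obtain ⟨γ, hγ⟩ : ∃ γ, J.u₁₁₂ / J.A = γ := ⟨_, rfl⟩
  have h₁ := mul_nonpos_of_nonneg_of_nonpos (J.D_pos hm).le J.max₁
  have h₂ := mul_nonpos_of_nonneg_of_nonpos J.A_pos.le J.max₂
  have c₁ := J.crit₁
  have c₂ := J.crit₂
  have hφ₁ : J.φ₁ / J.A = J.D * α + J.u₁₂₂ := by
    rw [GaussJet.φ₁, GaussJet.W, ← J.eqn₁, add_div, mul_div_assoc, hα, mul_div_cancel_left₀ _ hA]
  have e₁ : J.D * J.u₁₁₁ + J.A * J.u₁₂₂ = _ := J.eqn₁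
  have e₂ := J.eqn₂
  have e₁₁ : J.D * (J.u₁₁₁₁ / J.A) + J.A * (J.u₁₁₂₂ / J.A) + 2 * α * J.u₁₂₂ - 2 * γ ^ 2 * J.A
      = J.f₁₁ * J.W ^ 2 / J.A + 8 * J.f₁ * J.W * J.u₁ + 8 * J.f * J.u₁ ^ 2 * J.A
        + 4 * J.f * J.W * (J.A + J.u₁ * α + J.u₂ * γ) := by
    have := J.eqn₁₁
    rw [← GaussJet.W] at this
    rw [← hα, ← hγ]
    field_simp
    linear_combination this
  rw [hα] at h₁ c₁
  rw [hγ] at h₂ c₂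
  rw [← GaussJet.W] at e₁ e₂
  rw [hα, hγ, hφ₁]
  linear_combination h₁ + h₂ - e₁₁ - K * J.u₁ * e₁ - K * J.u₂ * e₂
    - 4 * J.f * J.W * (J.u₁ * c₁ + J.u₂ * c₂)

lemma neg_mul_le_third_order_terms₁ (hm : 0 < m) (hΛ : 1 ≤ Λ) (hA : 1 ≤ J.A) :
    -(441 * Λ ^ 10 / m * J.A) ≤
      J.D * (J.u₁₁₁ / J.A) ^ 2 - 2 * (J.u₁₁₁ / J.A) * (J.φ₁ / J.A) := by
  have hD := J.D_pos hm
  have hf := hm.le.trans J.le_f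
  have hW := J.one_le_W
  have hWle := J.W_le hΛ
  have hφ : |J.φ₁ / J.A| ≤ 21 * Λ ^ 5 := by
    rw [abs_div, abs_of_pos J.A_pos, div_le_iff₀ J.A_pos, GaussJet.φ₁]
    calc |J.f₁ * J.W ^ 2 + 4 * J.f * J.W * (J.u₁ * J.A)|
        ≤ |J.f₁| * J.W ^ 2 + 4 * J.f * J.W * (|J.u₁| * J.A) := by
          refine (abs_add_le _ _).trans_eq ?_
          simp only [abs_mul, abs_pow, abs_of_pos J.A_pos, abs_of_nonneg hf,
            abs_of_pos (zero_lt_one.trans_le hW), Nat.abs_ofNat]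
      _ ≤ Λ * (3 * Λ ^ 2) ^ 2 * 1 + 4 * Λ * (3 * Λ ^ 2) * (Λ * J.A) := by
          rw [mul_one]
          gcongr
          exacts [J.f₁_le, J.f_le, J.u₁_le]
      _ ≤ Λ * (3 * Λ ^ 2) ^ 2 * J.A + 4 * Λ * (3 * Λ ^ 2) * (Λ * J.A) := by gcongr
      _ ≤ 21 * Λ ^ 5 * J.A := by
          nlinarith [mul_le_mul_of_nonneg_right (pow_le_pow_right₀ hΛ (by norm_num : 4 ≤ 5))
            J.A_pos.le]
  calc -(441 * Λ ^ 10 / m * J.A) ≤ -((J.φ₁ / J.A) ^ 2 / J.D) := by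
        rw [neg_le_neg_iff, div_le_iff₀ hD]
        have hmAD := J.le_mul hm
        calc (J.φ₁ / J.A) ^ 2 ≤ (21 * Λ ^ 5) ^ 2 := by
              rw [← sq_abs]
              gcongr
          _ = 441 * Λ ^ 10 / m * m := by field_simp; ring
          _ ≤ 441 * Λ ^ 10 / m * (J.A * J.D) := by gcongr
          _ = _ := by ring
    _ ≤ _ := by
        rw [neg_le_iff_add_nonneg]
        have : 0 ≤ (J.D * (J.u₁₁₁ / J.A) - J.φ₁ / J.A) ^ 2 / J.D := by positivity
        refine this.trans_eq ?_
        field_simp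
        ring

lemma neg_le_third_order_terms₂ (hm : 0 < m) (hΛ : 1 ≤ Λ) (hA : 1 ≤ J.A) :
    -(81 * K ^ 2 * Λ ^ 12) ≤
      J.A * (J.u₁₁₂ / J.A) ^ 2 - 2 * J.A * (J.w₂ / J.w) ^ 2 := by
  have hD := J.D_pos hm
  set γ := J.u₁₁₂ / J.A
  set k := K * (J.u₂ * J.D)
  have hw : J.w₂ / J.w = -(γ + k) / 2 := by linear_combination J.crit₂ / 2
  have hk : J.A * k ^ 2 ≤ 81 * K ^ 2 * Λ ^ 12 := by
    calc J.A * k ^ 2 ≤ J.A * (J.A * k ^ 2) := le_mul_of_one_le_left (by positivity) hA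
      _ = K ^ 2 * |J.u₂| ^ 2 * (J.A * J.D) ^ 2 := by rw [sq_abs]; ring
      _ ≤ K ^ 2 * Λ ^ 2 * (9 * Λ ^ 5) ^ 2 := by
          have := mul_nonneg J.A_pos.le hD.le
          gcongr K ^ 2 * ?_ ^ 2 * ?_ ^ 2
          exacts [J.u₂_le, J.mul_le_pow hΛ]
      _ = 81 * K ^ 2 * Λ ^ 12 := by ring
  rw [hw]
  nlinarith [mul_nonneg J.A_pos.le (sq_nonneg (γ - k))]

lemma weight_terms_le (hm : 0 < m) (hΛ : 1 ≤ Λ) (hAw : 1 ≤ J.A * J.w) :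
    4 * (J.A * J.D) / J.w + 2 * J.D * (J.w₁ / J.w) ^ 2
      + 8 * J.f * J.W * (J.u₁ * J.w₁ + J.u₂ * J.w₂) / J.w ≤ 102 * Λ ^ 7 / J.w := by
  have hw := J.w_pos
  have hW := J.one_le_W
  have hpow : Λ ^ 5 ≤ Λ ^ 7 := pow_le_pow_right₀ hΛ (by norm_num)
  have hAD : 4 * (J.A * J.D) ≤ 36 * Λ ^ 7 := by linarith [J.mul_le_pow hΛ]
  have hD : 2 * J.D * J.w₁ ^ 2 / J.w ≤ 18 * Λ ^ 7 := by
    rw [div_le_iff₀ hw]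
    calc 2 * J.D * J.w₁ ^ 2 ≤ 2 * J.D * J.w₁ ^ 2 * (J.A * J.w) :=
          le_mul_of_one_le_right (by have := J.D_pos hm; positivity) hAw
      _ = 2 * (J.A * J.D) * |J.w₁| ^ 2 * J.w := by rw [sq_abs]; ring
      _ ≤ 2 * (9 * Λ ^ 5) * Λ ^ 2 * J.w := by
          gcongr 2 * ?_ * ?_ ^ 2 * J.w
          exacts [J.mul_le_pow hΛ, J.w₁_le]
      _ = 18 * Λ ^ 7 * J.w := by ring
  have hgrad : J.u₁ * J.w₁ + J.u₂ * J.w₂ ≤ Λ * Λ + Λ * Λ := by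
    refine (le_abs_self _).trans ((abs_add_le _ _).trans ?_)
    rw [abs_mul, abs_mul]
    gcongr
    exacts [J.u₁_le, J.w₁_le, J.u₂_le, J.w₂_le]
  have hcross : 8 * J.f * J.W * (J.u₁ * J.w₁ + J.u₂ * J.w₂) ≤ 48 * Λ ^ 7 := by
    have hf := hm.trans_le J.le_f
    calc 8 * J.f * J.W * (J.u₁ * J.w₁ + J.u₂ * J.w₂)
        ≤ 8 * J.f * J.W * (Λ * Λ + Λ * Λ) := by gcongr
      _ ≤ 8 * Λ * (3 * Λ ^ 2) * (Λ * Λ + Λ * Λ) := by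
          gcongr
          exacts [J.f_le, J.W_le hΛ]
      _ ≤ 48 * Λ ^ 7 := by linarith
  calc _ = (4 * (J.A * J.D) + 2 * J.D * J.w₁ ^ 2 / J.w
        + 8 * J.f * J.W * (J.u₁ * J.w₁ + J.u₂ * J.w₂)) / J.w := by field_simp
    _ ≤ 102 * Λ ^ 7 / J.w := by gcongr; linarith

lemma neg_le_curvature_terms (hK : 0 ≤ K) (hΛ : 1 ≤ Λ) (hA : 1 ≤ J.A) :
    -(33 * Λ ^ 5 + 18 * K * Λ ^ 6) ≤ J.f₁₁ * J.W ^ 2 / J.A + 8 * J.f₁ * J.W * J.u₁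
      + K * J.W ^ 2 * (J.u₁ * J.f₁ + J.u₂ * J.f₂) := by
  have hW := J.one_le_W
  have hWle := J.W_le hΛ
  have habs : |J.f₁₁ * J.W ^ 2 / J.A + 8 * J.f₁ * J.W * J.u₁
      + K * J.W ^ 2 * (J.u₁ * J.f₁ + J.u₂ * J.f₂)|
      ≤ |J.f₁₁| * J.W ^ 2 / J.A + 8 * |J.f₁| * J.W * |J.u₁|
        + K * J.W ^ 2 * (|J.u₁| * |J.f₁| + |J.u₂| * |J.f₂|) := by
    have hsum : |J.u₁ * J.f₁ + J.u₂ * J.f₂| ≤ |J.u₁| * |J.f₁| + |J.u₂| * |J.f₂| := by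
      simpa only [abs_mul] using abs_add_le (J.u₁ * J.f₁) (J.u₂ * J.f₂)
    refine (abs_add_three _ _ _).trans ?_
    simp only [abs_mul, abs_div, abs_pow, abs_of_pos J.A_pos, abs_of_nonneg hK,
      abs_of_pos (zero_lt_one.trans_le hW), Nat.abs_ofNat]
    gcongr
  have hbound : |J.f₁₁| * J.W ^ 2 / J.A + 8 * |J.f₁| * J.W * |J.u₁|
        + K * J.W ^ 2 * (|J.u₁| * |J.f₁| + |J.u₂| * |J.f₂|)
      ≤ Λ * (3 * Λ ^ 2) ^ 2 / 1 + 8 * Λ * (3 * Λ ^ 2) * Λ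
        + K * (3 * Λ ^ 2) ^ 2 * (Λ * Λ + Λ * Λ) := by
    gcongr
    exacts [J.f₁₁_le, J.f₁_le, J.u₁_le, J.u₁_le, J.f₁_le, J.u₂_le, J.f₂_le]
  have hpow : Λ ^ 4 ≤ Λ ^ 5 := pow_le_pow_right₀ hΛ (by norm_num)
  linarith [(abs_le.1 (habs.trans hbound)).1]

/-- Pogorelov's estimate at the maximum point: `K` is chosen so large that `K |∇u|² / 2` absorbs
the only other term which is linear in the eigenvalue `A`. -/
theorem exists_mul_le (hm : 0 < m) (hΛ : 1 ≤ Λ) :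
    ∃ K C : ℝ, 0 < K ∧ 0 < C ∧ ∀ J : CriticalJet K m Λ, J.A * J.w ≤ C := by
  set K := (441 * Λ ^ 10 / m + 1) / m
  have hK : 0 < K := by positivity
  have hKm : K * m = 441 * Λ ^ 10 / m + 1 := div_mul_cancel₀ _ hm.ne'
  set c := 33 * Λ ^ 5 + 18 * K * Λ ^ 6 + 81 * K ^ 2 * Λ ^ 12
  have hc : 0 < c := by positivity
  have hΛ₇ : 1 ≤ Λ ^ 7 := one_le_pow₀ hΛ
  refine ⟨K, c * Λ + 102 * Λ ^ 7 + Λ, hK, by positivity, fun J => ?_⟩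
  have hAw_le (a : ℝ) (ha : 0 ≤ a) : a * J.w ≤ a * Λ := mul_le_mul_of_nonneg_left J.w_le ha
  rcases le_total J.A 1 with hA | hA
  · nlinarith [hAw_le 1 zero_le_one, hAw_le c hc.le, J.w_pos]
  rcases le_total (J.A * J.w) 1 with hAw | hAw
  · nlinarith
  have hf := hm.trans_le J.le_f
  have hW := J.one_le_W
  have hmain := J.weighted_max_nonpos hm
  have hthird₁ := J.neg_mul_le_third_order_terms₁ hm hΛ hA
  have hthird₂ := J.neg_le_third_order_terms₂ hm hΛ hA
  have hweight := J.weight_terms_le hm hΛ hAw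
  have hcurv := J.neg_le_curvature_terms hK.le hΛ hA
  have hquad : K * m * J.A ≤ K * (J.A * J.D) * (J.A + J.D) := by
    have := J.D_pos hm
    gcongr
    exacts [J.le_mul hm, by linarith]
  have hpos : 0 ≤ 8 * J.f * J.u₁ ^ 2 * J.A + 4 * J.f * J.W * J.A := by positivity
  rw [hKm] at hquad
  have hA_le : J.A ≤ c + 102 * Λ ^ 7 / J.w := by linarith
  calc J.A * J.w ≤ (c + 102 * Λ ^ 7 / J.w) * J.w := mul_le_mul_of_nonneg_right hA_le J.w_pos.le
    _ = c * J.w + 102 * Λ ^ 7 := by field_simp [J.w_pos.ne']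
    _ ≤ _ := by linarith [hAw_le c hc.le]

end CriticalJet

lemma HasTwoJetAt.gauss_equation {a b d p q φ : ℝ → ℝ}
    {a₀ a₁ a₂ b₁ b₂ d₀ d₁ d₂ p₀ p₁ p₂ q₀ q₁ q₂ f₀ f₁ f₂ t₀ : ℝ}
    (ha : HasTwoJetAt a a₀ a₁ a₂ t₀) (hb : HasTwoJetAt b 0 b₁ b₂ t₀)
    (hd : HasTwoJetAt d d₀ d₁ d₂ t₀) (hp : HasTwoJetAt p p₀ p₁ p₂ t₀)
    (hq : HasTwoJetAt q q₀ q₁ q₂ t₀) (hφ : HasTwoJetAt φ f₀ f₁ f₂ t₀)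
    (h : ∀ᶠ t in 𝓝 t₀, a t * d t - b t ^ 2 = φ t * (1 + p t ^ 2 + q t ^ 2) ^ 2) :
    a₀ * d₀ = f₀ * (1 + p₀ ^ 2 + q₀ ^ 2) ^ 2 ∧
    d₀ * a₁ + a₀ * d₁ = f₁ * (1 + p₀ ^ 2 + q₀ ^ 2) ^ 2
      + 4 * f₀ * (1 + p₀ ^ 2 + q₀ ^ 2) * (p₀ * p₁ + q₀ * q₁) ∧
    d₀ * a₂ + a₀ * d₂ + 2 * a₁ * d₁ - 2 * b₁ ^ 2 = f₂ * (1 + p₀ ^ 2 + q₀ ^ 2) ^ 2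
      + 8 * f₁ * (1 + p₀ ^ 2 + q₀ ^ 2) * (p₀ * p₁ + q₀ * q₁)
      + 8 * f₀ * (p₀ * p₁ + q₀ * q₁) ^ 2
      + 4 * f₀ * (1 + p₀ ^ 2 + q₀ ^ 2) * (p₁ ^ 2 + q₁ ^ 2 + p₀ * p₂ + q₀ * q₂) := by
  have hl := ((ha.mul hd).sub hb.sq).congr h
  obtain ⟨h₀, h₁, h₂⟩ := hl.unique (hφ.mul ((((const 1 t₀).add hp.sq).add hq.sq).sq))
  refine ⟨?_, ?_, ?_⟩
  · linear_combination h₀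
  · linear_combination h₁
  · linear_combination h₂

section HigherDirectionalDerivatives

variable {V : Type*} [NormedAddCommGroup V] [NormedSpace ℝ V] {g : V → ℝ} {x : V}

lemma dirDeriv_three_comm (hg : ContDiffAt ℝ 3 g x) (v w : V) :
    dirDeriv v (dirDeriv v (dirDeriv w g)) x = dirDeriv w (dirDeriv v (dirDeriv v g)) x :=
  (dirDeriv_congr (dirDeriv_comm_eventuallyEq (hg.of_le (by norm_num)) v w) v).trans
    (dirDeriv_comm (contDiffAt_dirDeriv hg (by norm_num) v) v w)

lemma dirDeriv_four_comm (hg : ContDiffAt ℝ 4 g x) (v w : V) :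
    dirDeriv v (dirDeriv v (dirDeriv w (dirDeriv w g))) x =
      dirDeriv w (dirDeriv w (dirDeriv v (dirDeriv v g))) x := by
  rw [dirDeriv_three_comm (contDiffAt_dirDeriv hg (by norm_num) w) v w]
  refine dirDeriv_congr ?_ w
  filter_upwards [hg.eventually (by norm_num)] with y hy
  exact dirDeriv_three_comm (hy.of_le (by norm_num)) v w

lemma abs_dirDeriv_le {v : V} (hv : ‖v‖ = 1) (g : V → ℝ) (x : V) :
    |dirDeriv v g x| ≤ ‖fderiv ℝ g x‖ := by
  simpa [dirDeriv, hv] using (fderiv ℝ g x).le_opNorm v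

end HigherDirectionalDerivatives

section GaussCurvature

variable {V : Type*} [NormedAddCommGroup V] [InnerProductSpace ℝ V]

/-- `u` is a convex `C⁴` solution of the equation `det ∇²u = f (1 + |∇u|²)²` of prescribed Gauss
curvature `f` in the ball of radius `R` of a Euclidean plane, the gradient of `u` is bounded by `L`,
and `f` takes values in `[m, Λ]` and has first and second derivatives bounded by `Λ`. -/
structure IsBoundedSolution (m Λ L R : ℝ) (u f : V → ℝ) : Prop where
  contDiffOn : ContDiffOn ℝ 4 u (ball 0 R)
  convexOn : ConvexOn ℝ (ball 0 R) u
  hessDet_eq : ∀ (b : OrthonormalBasis (Fin 2) ℝ V), ∀ x ∈ ball 0 R,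
    hessDet b u x = f x * (1 + ‖fderiv ℝ u x‖ ^ 2) ^ 2
  le_curvature : ∀ x ∈ ball 0 R, m ≤ f x
  curvature_le : ∀ x ∈ ball 0 R, f x ≤ Λ
  norm_fderiv_curvature_le : ∀ x ∈ ball 0 R, ‖fderiv ℝ f x‖ ≤ Λ
  abs_fderiv_fderiv_curvature_le : ∀ x ∈ ball 0 R, ∀ ξ : V, ‖ξ‖ = 1 →
    |fderiv ℝ (fderiv ℝ f) x ξ ξ| ≤ Λ
  norm_fderiv_le : ∀ x ∈ ball 0 R, ‖fderiv ℝ u x‖ ≤ L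

lemma norm_fderiv_sq (b : OrthonormalBasis (Fin 2) ℝ V) (u : V → ℝ) (x : V) :
    ‖fderiv ℝ u x‖ ^ 2 = dirDeriv (b 0) u x ^ 2 + dirDeriv (b 1) u x ^ 2 := by
  rw [b.norm_dual, Fin.sum_univ_two]
  rfl

/-- The height `δ + u 0 + ∇u 0 ⬝ x - u x` of the lifted tangent plane at the origin above the graph
of `u`; it is positive exactly on the section of `u` of height `δ`. -/
noncomputable def sectionWeight (δ : ℝ) (u : V → ℝ) (x : V) : ℝ :=
  fderiv ℝ u 0 x + (δ + u 0) - u x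

lemma hasTwoJetAt_sectionWeight {u : V → ℝ} {x : V} (δ : ℝ) (hu : ContDiffAt ℝ 2 u x) (v : V) :
    HasTwoJetAt (fun t : ℝ => sectionWeight δ u (x + t • v)) (sectionWeight δ u x)
      (dirDeriv v u 0 - dirDeriv v u x) (-dirDeriv v (dirDeriv v u) x) 0 := by
  unfold sectionWeight
  have h := (hasTwoJetAt_clm_line (fderiv ℝ u 0) (δ + u 0) x v).sub (hasTwoJetAt_line hu v)
  rwa [zero_sub] at h

namespace IsBoundedSolution

variable {m Λ L R δ K : ℝ} {u f : V → ℝ} {x : V} (hsol : IsBoundedSolution m Λ L R u f)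

include hsol

lemma contDiffAt (hx : x ∈ ball 0 R) : ContDiffAt ℝ 4 u x :=
  hsol.contDiffOn.contDiffAt (isOpen_ball.mem_nhds hx)

lemma mul_sub_sq_eq (b : OrthonormalBasis (Fin 2) ℝ V) (hx : x ∈ ball 0 R) :
    dirDeriv (b 0) (dirDeriv (b 0) u) x * dirDeriv (b 1) (dirDeriv (b 1) u) x
      - dirDeriv (b 0) (dirDeriv (b 1) u) x ^ 2 =
      f x * (1 + dirDeriv (b 0) u x ^ 2 + dirDeriv (b 1) u x ^ 2) ^ 2 := by
  rw [← hessDet_eq_mul_sub_sq b ((hsol.contDiffAt hx).of_le (by norm_num)), hsol.hessDet_eq b x hx,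
    norm_fderiv_sq b, add_assoc]

lemma contDiffAt_curvature (b : OrthonormalBasis (Fin 2) ℝ V) (hx : x ∈ ball 0 R) :
    ContDiffAt ℝ 2 f x := by
  have h₁ (i : Fin 2) : ContDiffAt ℝ 3 (dirDeriv (b i) u) x :=
    contDiffAt_dirDeriv (hsol.contDiffAt hx) (by norm_num) _
  have h₁' (i : Fin 2) : ContDiffAt ℝ 2 (dirDeriv (b i) u) x := (h₁ i).of_le (by norm_num)
  have h₂ (i j : Fin 2) : ContDiffAt ℝ 2 (dirDeriv (b i) (dirDeriv (b j) u)) x :=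
    contDiffAt_dirDeriv (h₁ j) (by norm_num) _
  have hW : ∀ y, (1 + dirDeriv (b 0) u y ^ 2 + dirDeriv (b 1) u y ^ 2) ^ 2 ≠ 0 := fun y => by
    positivity
  refine ((((h₂ 0 0).mul (h₂ 1 1)).sub ((h₂ 0 1).pow 2)).div
    (((contDiffAt_const (c := 1).add ((h₁' 0).pow 2)).add ((h₁' 1).pow 2)).pow 2)
    (hW x)).congr_of_eventuallyEq ?_
  filter_upwards [isOpen_ball.mem_nhds hx] with y hy
  exact eq_div_of_mul_eq (hW y) (hsol.mul_sub_sq_eq b hy).symm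

lemma differentiated_equation (b : OrthonormalBasis (Fin 2) ℝ V) (hx : x ∈ ball 0 R)
    (hmixed : dirDeriv (b 0) (dirDeriv (b 1) u) x = 0) :
    let W := 1 + dirDeriv (b 0) u x ^ 2 + dirDeriv (b 1) u x ^ 2
    let A := dirDeriv (b 0) (dirDeriv (b 0) u)
    let D := dirDeriv (b 1) (dirDeriv (b 1) u)
    A x * D x = f x * W ^ 2 ∧
    D x * dirDeriv (b 0) A x + A x * dirDeriv (b 0) D x =
      dirDeriv (b 0) f x * W ^ 2 + 4 * f x * W * (dirDeriv (b 0) u x * A x) ∧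
    D x * dirDeriv (b 1) A x + A x * dirDeriv (b 1) D x =
      dirDeriv (b 1) f x * W ^ 2 + 4 * f x * W * (dirDeriv (b 1) u x * D x) ∧
    D x * dirDeriv (b 0) (dirDeriv (b 0) A) x + A x * dirDeriv (b 1) (dirDeriv (b 1) A) x
        + 2 * dirDeriv (b 0) A x * dirDeriv (b 0) D x - 2 * dirDeriv (b 1) A x ^ 2 =
      dirDeriv (b 0) (dirDeriv (b 0) f) x * W ^ 2
        + 8 * dirDeriv (b 0) f x * W * (dirDeriv (b 0) u x * A x)
        + 8 * f x * (dirDeriv (b 0) u x * A x) ^ 2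
        + 4 * f x * W * (A x ^ 2 + dirDeriv (b 0) u x * dirDeriv (b 0) A x
          + dirDeriv (b 1) u x * dirDeriv (b 1) A x) := by
  have hu := hsol.contDiffAt hx
  have hu₃ : ContDiffAt ℝ 3 u x := hu.of_le (by norm_num)
  have hmixed' : dirDeriv (b 1) (dirDeriv (b 0) u) x = 0 :=
    (dirDeriv_comm (hu.of_le (by norm_num)) _ _).trans hmixed
  have h₁ (i : Fin 2) : ContDiffAt ℝ 2 (dirDeriv (b i) u) x :=
    contDiffAt_dirDeriv hu₃ (by norm_num) _
  have h₂ (i j : Fin 2) : ContDiffAt ℝ 2 (dirDeriv (b i) (dirDeriv (b j) u)) x :=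
    contDiffAt_dirDeriv (contDiffAt_dirDeriv hu (m := 3) (by norm_num) _) (by norm_num) _
  have hjet (v : V) := HasTwoJetAt.gauss_equation (hasTwoJetAt_line (h₂ 0 0) v)
    (hmixed ▸ hasTwoJetAt_line (h₂ 0 1) v) (hasTwoJetAt_line (h₂ 1 1) v)
    (hasTwoJetAt_line (h₁ 0) v) (hasTwoJetAt_line (h₁ 1) v)
    (hasTwoJetAt_line (hsol.contDiffAt_curvature b hx) v)
    (((tendsto_add_smul_nhds x v).eventually (isOpen_ball.mem_nhds hx)).mono
      fun t ht => hsol.mul_sub_sq_eq b ht)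
  obtain ⟨eqn, eqn₁, eqn₁₁⟩ := hjet (b 0)
  obtain ⟨-, eqn₂, -⟩ := hjet (b 1)
  simp only [dirDeriv_three_comm hu₃ (b 0) (b 1), dirDeriv_four_comm hu (b 0) (b 1), hmixed,
    hmixed'] at eqn₁ eqn₁₁ eqn₂
  refine ⟨eqn, ?_, ?_, ?_⟩
  · linear_combination eqn₁
  · linear_combination eqn₂
  · linear_combination eqn₁₁

/-- The derivatives of a solution at a point, in a frame diagonalising its Hessian. -/
noncomputable def gaussJet (b : OrthonormalBasis (Fin 2) ℝ V) (hx : x ∈ ball 0 R)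
    (hmixed : dirDeriv (b 0) (dirDeriv (b 1) u) x = 0)
    (hA : 0 < dirDeriv (b 0) (dirDeriv (b 0) u) x) (hLΛ : L ≤ Λ) : GaussJet m Λ :=
  have hu_le (i : Fin 2) : |dirDeriv (b i) u x| ≤ Λ :=
    (abs_dirDeriv_le (b.norm_eq_one i) u x).trans ((hsol.norm_fderiv_le x hx).trans hLΛ)
  have hf_le (i : Fin 2) : |dirDeriv (b i) f x| ≤ Λ :=
    (abs_dirDeriv_le (b.norm_eq_one i) f x).trans (hsol.norm_fderiv_curvature_le x hx)
  have heqn := hsol.differentiated_equation b hx hmixed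
  { u₁ := dirDeriv (b 0) u x
    u₂ := dirDeriv (b 1) u x
    A := dirDeriv (b 0) (dirDeriv (b 0) u) x
    D := dirDeriv (b 1) (dirDeriv (b 1) u) x
    u₁₁₁ := dirDeriv (b 0) (dirDeriv (b 0) (dirDeriv (b 0) u)) x
    u₁₁₂ := dirDeriv (b 1) (dirDeriv (b 0) (dirDeriv (b 0) u)) x
    u₁₂₂ := dirDeriv (b 0) (dirDeriv (b 1) (dirDeriv (b 1) u)) x
    u₂₂₂ := dirDeriv (b 1) (dirDeriv (b 1) (dirDeriv (b 1) u)) x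
    u₁₁₁₁ := dirDeriv (b 0) (dirDeriv (b 0) (dirDeriv (b 0) (dirDeriv (b 0) u))) x
    u₁₁₂₂ := dirDeriv (b 1) (dirDeriv (b 1) (dirDeriv (b 0) (dirDeriv (b 0) u))) x
    f := f x
    f₁ := dirDeriv (b 0) f x
    f₂ := dirDeriv (b 1) f x
    f₁₁ := dirDeriv (b 0) (dirDeriv (b 0) f) x
    A_pos := hA
    le_f := hsol.le_curvature x hx
    f_le := hsol.curvature_le x hx
    f₁_le := hf_le 0
    f₂_le := hf_le 1
    f₁₁_le := by
      rw [dirDeriv_dirDeriv (hsol.contDiffAt_curvature b hx)]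
      exact hsol.abs_fderiv_fderiv_curvature_le x hx _ (b.norm_eq_one 0)
    u₁_le := hu_le 0
    u₂_le := hu_le 1
    eqn := heqn.1
    eqn₁ := heqn.2.1
    eqn₂ := heqn.2.2.1
    eqn₁₁ := heqn.2.2.2 }

lemma exists_criticalJet (b : OrthonormalBasis (Fin 2) ℝ V) (hx : x ∈ ball 0 R)
    (hmixed : dirDeriv (b 0) (dirDeriv (b 1) u) x = 0)
    (hA : 0 < dirDeriv (b 0) (dirDeriv (b 0) u) x) (hw : 0 < sectionWeight δ u x)
    (hwΛ : sectionWeight δ u x ≤ Λ) (hLΛ : 2 * L ≤ Λ)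
    (hmax : IsLocalMax (fun y => Real.log (dirDeriv (b 0) (dirDeriv (b 0) u) y)
      + 2 * Real.log (sectionWeight δ u y)
      + K / 2 * (dirDeriv (b 0) u y ^ 2 + dirDeriv (b 1) u y ^ 2)) x) :
    ∃ J : CriticalJet K m Λ,
      J.A = dirDeriv (b 0) (dirDeriv (b 0) u) x ∧ J.w = sectionWeight δ u x := by
  have hu := hsol.contDiffAt hx
  have hu₃ : ContDiffAt ℝ 3 u x := hu.of_le (by norm_num)
  have hu₂ : ContDiffAt ℝ 2 u x := hu.of_le (by norm_num)
  have hmixed' : dirDeriv (b 1) (dirDeriv (b 0) u) x = 0 := (dirDeriv_comm hu₂ _ _).trans hmixed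
  have h₁ (w : V) : ContDiffAt ℝ 2 (dirDeriv w u) x := contDiffAt_dirDeriv hu₃ (by norm_num) w
  have h₂ : ContDiffAt ℝ 2 (dirDeriv (b 0) (dirDeriv (b 0) u)) x :=
    contDiffAt_dirDeriv (contDiffAt_dirDeriv hu (m := 3) (by norm_num) _) (by norm_num) _
  have hjet (v : V) := (((hasTwoJetAt_line h₂ v).log hA.ne').add
    (((hasTwoJetAt_sectionWeight δ hu₂ v).log hw.ne').const_mul 2)).add
    (((hasTwoJetAt_line (h₁ (b 0)) v).sq.add
      (hasTwoJetAt_line (h₁ (b 1)) v).sq).const_mul (K / 2))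
  obtain ⟨crit₁, max₁⟩ := (hjet (b 0)).of_isLocalMax (isLocalMax_line hmax _)
  obtain ⟨crit₂, max₂⟩ := (hjet (b 1)).of_isLocalMax (isLocalMax_line hmax _)
  simp only [dirDeriv_three_comm hu₃ (b 0) (b 1), dirDeriv_three_comm hu₃ (b 1) (b 0),
    hmixed, hmixed'] at crit₁ max₁ crit₂ max₂
  have hL₀ := hsol.norm_fderiv_le 0 (mem_ball_self (pos_of_mem_ball hx))
  have hw_le (i : Fin 2) : |dirDeriv (b i) u 0 - dirDeriv (b i) u x| ≤ Λ := by
    have := (abs_dirDeriv_le (b.norm_eq_one i) u x).trans (hsol.norm_fderiv_le x hx)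
    have := (abs_dirDeriv_le (b.norm_eq_one i) u 0).trans hL₀
    exact (abs_sub _ _).trans (by linarith)
  exact ⟨{
    toGaussJet := hsol.gaussJet b hx hmixed hA (by linarith [(norm_nonneg _).trans hL₀])
    w := sectionWeight δ u x
    w₁ := dirDeriv (b 0) u 0 - dirDeriv (b 0) u x
    w₂ := dirDeriv (b 1) u 0 - dirDeriv (b 1) u x
    w_pos := hw
    w_le := hwΛ
    w₁_le := hw_le 0
    w₂_le := hw_le 1
    crit₁ := by dsimp only [gaussJet]; linear_combination crit₁
    crit₂ := by dsimp only [gaussJet]; linear_combination crit₂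
    max₁ := by dsimp only [gaussJet]; linear_combination max₁
    max₂ := by dsimp only [gaussJet]; linear_combination max₂ }, rfl, rfl⟩

end IsBoundedSolution
end GaussCurvature

section PogorelovEstimate

variable {V : Type*} [NormedAddCommGroup V] [InnerProductSpace ℝ V]

lemma sectionWeight_zero (δ : ℝ) (u : V → ℝ) : sectionWeight δ u 0 = δ := by
  simp [sectionWeight]

lemma sectionWeight_le {δ : ℝ} {u : V → ℝ} {s : Set V} {x : V} (hconv : ConvexOn ℝ s u)
    (h₀ : (0 : V) ∈ s) (hx : x ∈ s) (hu : DifferentiableAt ℝ u 0) : sectionWeight δ u x ≤ δ := by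
  have h := add_fderiv_le_of_convexOn hconv h₀ hx hu
  rw [sub_zero] at h
  unfold sectionWeight
  linarith

lemma dirDeriv_dirDeriv_eq_zero_of_isMaxOn (b : OrthonormalBasis (Fin 2) ℝ V) {u : V → ℝ} {x : V}
    (hu : ContDiffAt ℝ 2 u x)
    (hmax : IsMaxOn (fun ξ => fderiv ℝ (fderiv ℝ u) x ξ ξ) (sphere 0 1) (b 0)) :
    dirDeriv (b 0) (dirDeriv (b 1) u) x = 0 := by
  have hle (θ : ℝ) : dirDeriv (b 0) (dirDeriv (b 0) u) x * Real.cos θ ^ 2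
      + 2 * dirDeriv (b 0) (dirDeriv (b 1) u) x * (Real.cos θ * Real.sin θ)
      + dirDeriv (b 1) (dirDeriv (b 1) u) x * Real.sin θ ^ 2 ≤
      dirDeriv (b 0) (dirDeriv (b 0) u) x := by
    have hnorm : ‖Real.cos θ • b 0 + Real.sin θ • b 1‖ = 1 := by
      rw [← sq_eq_sq₀ (norm_nonneg _) zero_le_one, norm_add_sq_real]
      simp [inner_smul_left, inner_smul_right, norm_smul, b.inner_eq_zero]
    rw [← dirDeriv_dirDeriv_lin hu, dirDeriv_dirDeriv hu, dirDeriv_dirDeriv hu]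
    exact hmax (mem_sphere_zero_iff_norm.2 hnorm)
  have hderiv := ((((Real.hasDerivAt_cos 0).pow 2).const_mul
    (dirDeriv (b 0) (dirDeriv (b 0) u) x)).add
    (((Real.hasDerivAt_cos 0).mul (Real.hasDerivAt_sin 0)).const_mul
      (2 * dirDeriv (b 0) (dirDeriv (b 1) u) x))).add
    (((Real.hasDerivAt_sin 0).pow 2).const_mul (dirDeriv (b 1) (dirDeriv (b 1) u) x))
  have h₀ := IsLocalMax.hasDerivAt_eq_zero (.of_forall fun θ => by simpa using hle θ) hderiv
  simpa using h₀

/-- Pogorelov's test function: the second derivative of `u` in the direction `ξ`, times the square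
of the weight of the section of height `δ`, cut off outside the section, times
`exp (K |∇u|² / 2)`. -/
noncomputable def pogorelovFun (δ K : ℝ) (u : V → ℝ) (x ξ : V) : ℝ :=
  fderiv ℝ (fderiv ℝ u) x ξ ξ * max (sectionWeight δ u x) 0 ^ 2
    * Real.exp (K / 2 * ‖fderiv ℝ u x‖ ^ 2)

lemma log_pogorelovFun {δ K : ℝ} {u : V → ℝ} {x ξ : V} (hA : 0 < fderiv ℝ (fderiv ℝ u) x ξ ξ)
    (hw : 0 < sectionWeight δ u x) :
    Real.log (pogorelovFun δ K u x ξ) = Real.log (fderiv ℝ (fderiv ℝ u) x ξ ξ)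
      + 2 * Real.log (sectionWeight δ u x) + K / 2 * ‖fderiv ℝ u x‖ ^ 2 := by
  rw [pogorelovFun, max_eq_left hw.le, Real.log_mul (by positivity) (by positivity), Real.log_exp,
    Real.log_mul (by positivity) (by positivity), Real.log_pow, Nat.cast_ofNat]

lemma pos_of_pogorelovFun_pos {δ K : ℝ} {u : V → ℝ} {x ξ : V} (h : 0 < pogorelovFun δ K u x ξ) :
    0 < fderiv ℝ (fderiv ℝ u) x ξ ξ ∧ 0 < sectionWeight δ u x := by
  have h' := pos_of_mul_pos_left h (Real.exp_pos _).le
  refine ⟨pos_of_mul_pos_left h' (sq_nonneg _), ?_⟩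
  by_contra! hw
  simp [max_eq_right hw] at h'

lemma continuousAt_pogorelovFun {δ K : ℝ} {u : V → ℝ} {p : V × V} (hu : ContDiffAt ℝ 2 u p.1) :
    ContinuousAt (fun p : V × V => pogorelovFun δ K u p.1 p.2) p := by
  have h₁ : ContDiffAt ℝ 1 (fderiv ℝ u) p.1 := hu.fderiv_right (by norm_num)
  have c₁ : ContinuousAt (fun p : V × V => fderiv ℝ u p.1) p :=
    h₁.continuousAt.comp continuousAt_fst
  have c₂ : ContinuousAt (fun p : V × V => fderiv ℝ (fderiv ℝ u) p.1) p :=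
    (h₁.fderiv_right (m := 0) (by norm_num)).continuousAt.comp continuousAt_fst
  unfold pogorelovFun sectionWeight
  fun_prop

namespace IsBoundedSolution

variable {m Λ Λ' L R δ K : ℝ} {u f : V → ℝ} {x : V}

lemma mono (hsol : IsBoundedSolution m Λ L R u f) (hΛ : Λ ≤ Λ') :
    IsBoundedSolution m Λ' L R u f :=
  { hsol with
    curvature_le := fun x hx => (hsol.curvature_le x hx).trans hΛ
    norm_fderiv_curvature_le := fun x hx => (hsol.norm_fderiv_curvature_le x hx).trans hΛ
    abs_fderiv_fderiv_curvature_le := fun x hx ξ hξ =>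
      (hsol.abs_fderiv_fderiv_curvature_le x hx ξ hξ).trans hΛ }

variable (hsol : IsBoundedSolution m Λ L R u f)

include hsol

lemma le_hessDet (hm : 0 < m) (b : OrthonormalBasis (Fin 2) ℝ V) (hx : x ∈ ball 0 R) :
    m ≤ hessDet b u x := by
  rw [hsol.hessDet_eq b x hx]
  have hf := hsol.le_curvature x hx
  exact hf.trans (le_mul_of_one_le_right (hm.le.trans hf)
    (one_le_pow₀ (le_add_of_nonneg_right (sq_nonneg _))))

lemma exists_criticalJet_of_isMaxOn {s : Set V} (b : OrthonormalBasis (Fin 2) ℝ V)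
    (hx : x ∈ ball 0 R) (hs : s ∈ 𝓝 x) (hδΛ : δ ≤ Λ) (hLΛ : 2 * L ≤ Λ)
    (hmax : IsMaxOn (fun p : V × V => pogorelovFun δ K u p.1 p.2) (s ×ˢ sphere 0 1) (x, b 0))
    (hpos : 0 < pogorelovFun δ K u x (b 0)) :
    ∃ J : CriticalJet K m Λ,
      J.A = fderiv ℝ (fderiv ℝ u) x (b 0) (b 0) ∧ J.w = sectionWeight δ u x := by
  have hu : ContDiffAt ℝ 2 u x := (hsol.contDiffAt hx).of_le (by norm_num)
  have h₀ : (0 : V) ∈ ball 0 R := mem_ball_self (pos_of_mem_ball hx)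
  have hb : b 0 ∈ sphere (0 : V) 1 := mem_sphere_zero_iff_norm.2 (b.norm_eq_one 0)
  obtain ⟨hA, hw⟩ := pos_of_pogorelovFun_pos hpos
  have hmixed : dirDeriv (b 0) (dirDeriv (b 1) u) x = 0 := by
    refine dirDeriv_dirDeriv_eq_zero_of_isMaxOn b hu fun ξ hξ => ?_
    have h := hmax (show (x, ξ) ∈ s ×ˢ sphere 0 1 from ⟨mem_of_mem_nhds hs, hξ⟩)
    simp only [Set.mem_ofPred_eq, pogorelovFun, mul_assoc] at h
    exact le_of_mul_le_mul_right h (by rw [max_eq_left hw.le]; positivity)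
  have hlog : IsLocalMax (fun y => Real.log (dirDeriv (b 0) (dirDeriv (b 0) u) y)
      + 2 * Real.log (sectionWeight δ u y)
      + K / 2 * (dirDeriv (b 0) u y ^ 2 + dirDeriv (b 1) u y ^ 2)) x := by
    have hcont : ContinuousAt (fun y => pogorelovFun δ K u y (b 0)) x :=
      (continuousAt_pogorelovFun (p := (x, b 0)) hu).comp (f := fun y : V => (y, b 0)) (by fun_prop)
    filter_upwards [hs, hcont.eventually (lt_mem_nhds hpos), hu.eventually (by norm_num)]
      with y hys hy huy
    have hle : pogorelovFun δ K u y (b 0) ≤ pogorelovFun δ K u x (b 0) :=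
      hmax (show (y, b 0) ∈ s ×ˢ sphere 0 1 from ⟨hys, hb⟩)
    obtain ⟨hyA, hyw⟩ := pos_of_pogorelovFun_pos hy
    simpa only [dirDeriv_dirDeriv hu, dirDeriv_dirDeriv huy, ← norm_fderiv_sq,
      log_pogorelovFun (K := K) hyA hyw, log_pogorelovFun (K := K) hA hw] using
      Real.log_le_log hy hle
  rw [← dirDeriv_dirDeriv hu] at hA ⊢
  have hwΛ := (sectionWeight_le hsol.convexOn h₀ hx
    ((hsol.contDiffAt h₀).differentiableAt (by norm_num))).trans hδΛ
  exact hsol.exists_criticalJet b hx hmixed hA hw hwΛ hLΛ hlog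

lemma exists_isMaxOn_pogorelovFun (b : OrthonormalBasis (Fin 2) ℝ V) {r : ℝ} (hr : 0 ≤ r)
    (hrR : r < R) (δ K : ℝ) :
    ∃ p ∈ closedBall (0 : V) r ×ˢ sphere (0 : V) 1,
      IsMaxOn (fun p : V × V => pogorelovFun δ K u p.1 p.2) (closedBall 0 r ×ˢ sphere 0 1) p := by
  have : FiniteDimensional ℝ V := b.toBasis.finiteDimensional_of_finite
  refine ((isCompact_closedBall _ _).prod (isCompact_sphere _ _)).exists_isMaxOn
    ⟨(0, b 0), mem_closedBall_self hr, mem_sphere_zero_iff_norm.2 (b.norm_eq_one 0)⟩ ?_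
  exact fun p hp => (continuousAt_pogorelovFun ((hsol.contDiffAt
    (closedBall_subset_ball hrR hp.1)).of_le (by norm_num))).continuousWithinAt

theorem fderiv_fderiv_mul_le {C r : ℝ} (b : OrthonormalBasis (Fin 2) ℝ V) (hr : 0 ≤ r) (hrR : r < R)
    (hδ : 0 < δ) (hδΛ : δ ≤ Λ) (hLΛ : 2 * L ≤ Λ) (hK : 0 ≤ K) (hC : 0 ≤ C)
    (hJ : ∀ J : CriticalJet K m Λ, J.A * J.w ≤ C)
    (hsec : ∀ x, ‖x‖ = r → sectionWeight δ u x ≤ 0) {ξ : V} (hξ : ‖ξ‖ = 1) :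
    fderiv ℝ (fderiv ℝ u) 0 ξ ξ * δ ≤ C * Real.exp (K / 2 * L ^ 2) := by
  obtain ⟨⟨x, η⟩, ⟨hx, hη⟩, hmax⟩ := hsol.exists_isMaxOn_pogorelovFun b hr hrR δ K
  have hle : pogorelovFun δ K u 0 ξ ≤ pogorelovFun δ K u x η :=
    hmax (show (0, ξ) ∈ closedBall 0 r ×ˢ sphere 0 1 from
      ⟨mem_closedBall_self hr, mem_sphere_zero_iff_norm.2 hξ⟩)
  have h₀R : (0 : V) ∈ ball 0 R := mem_ball_self (hr.trans_lt hrR)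
  have hxR : x ∈ ball 0 R := closedBall_subset_ball hrR hx
  rcases le_or_gt (fderiv ℝ (fderiv ℝ u) 0 ξ ξ) 0 with hneg | hA₀
  · exact (mul_nonpos_of_nonpos_of_nonneg hneg hδ.le).trans (by positivity)
  have hlow : fderiv ℝ (fderiv ℝ u) 0 ξ ξ * δ ^ 2 ≤ pogorelovFun δ K u 0 ξ := by
    rw [pogorelovFun, sectionWeight_zero, max_eq_left hδ.le]
    exact le_mul_of_one_le_right (by positivity) (Real.one_le_exp (by positivity))
  have hpos : 0 < pogorelovFun δ K u x η := (by positivity : (0 : ℝ) < _).trans_le (hlow.trans hle)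
  obtain ⟨-, hw⟩ := pos_of_pogorelovFun_pos hpos
  have hxr : ‖x‖ < r := (mem_closedBall_zero_iff.1 hx).lt_of_ne fun h => hw.not_ge (hsec x h)
  obtain ⟨b', rfl⟩ := exists_orthonormalBasis_apply_zero_eq b (mem_sphere_zero_iff_norm.1 hη)
  obtain ⟨J, hJA, hJw⟩ := hsol.exists_criticalJet_of_isMaxOn b' hxR
    (closedBall_mem_nhds_of_mem (mem_ball_zero_iff.2 hxr)) hδΛ hLΛ hmax hpos
  have hwδ : sectionWeight δ u x ≤ δ := sectionWeight_le hsol.convexOn h₀R hxR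
    ((hsol.contDiffAt h₀R).differentiableAt (by norm_num))
  have hgrad : ‖fderiv ℝ u x‖ ^ 2 ≤ L ^ 2 :=
    pow_le_pow_left₀ (norm_nonneg _) (hsol.norm_fderiv_le x hxR) 2
  refine le_of_mul_le_mul_right ?_ hδ
  calc fderiv ℝ (fderiv ℝ u) 0 ξ ξ * δ * δ
      ≤ pogorelovFun δ K u x (b' 0) := by linarith
    _ = J.A * J.w * sectionWeight δ u x * Real.exp (K / 2 * ‖fderiv ℝ u x‖ ^ 2) := by
      rw [pogorelovFun, max_eq_left hw.le, hJA, hJw]; ring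
    _ ≤ C * δ * Real.exp (K / 2 * L ^ 2) := by gcongr; exact hJ J
    _ = C * Real.exp (K / 2 * L ^ 2) * δ := by ring

end IsBoundedSolution

theorem exists_fderiv_fderiv_le {m R L : ℝ} (hm : 0 < m) (hR : 0 < R) (hL : 0 ≤ L)
    (b : OrthonormalBasis (Fin 2) ℝ V) (Λ : ℝ) :
    ∃ C, ∀ u f : V → ℝ, IsBoundedSolution m Λ L R u f →
      ∀ ξ : V, ‖ξ‖ = 1 → fderiv ℝ (fderiv ℝ u) 0 ξ ξ ≤ C := by
  obtain ⟨δ, hδ, hstrict⟩ := exists_pos_lt_sub_tangent hm hR hL b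
  let Λ' := max 1 Λ + (δ + 2 * L)
  have hΛ : max 1 Λ ≤ Λ' := le_add_of_nonneg_right (by positivity)
  obtain ⟨h1Λ, hΛΛ⟩ := max_le_iff.1 hΛ
  have hδΛ : δ ≤ Λ' := by linarith [le_max_left 1 Λ]
  have hLΛ : 2 * L ≤ Λ' := by linarith [le_max_left 1 Λ]
  obtain ⟨K, C, hK, hC, hJ⟩ := CriticalJet.exists_mul_le hm h1Λ
  refine ⟨C * Real.exp (K / 2 * L ^ 2) / δ, fun u f hsol ξ hξ => (le_div_iff₀ hδ).2 ?_⟩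
  refine (hsol.mono hΛΛ).fderiv_fderiv_mul_le b (half_pos hR).le (half_lt_self hR) hδ hδΛ hLΛ hK.le
    hC.le hJ (fun x hx => ?_) hξ
  have h := hstrict u (hsol.contDiffOn.of_le (by norm_num)) hsol.convexOn hsol.norm_fderiv_le
    (fun y hy => hsol.le_hessDet hm b hy) x hx
  unfold sectionWeight
  linarith

end PogorelovEstimate

section EuclideanPlane

local notation "ℝ²" => EuclideanSpace ℝ (Fin 2)

variable {u f : ℝ² → ℝ} {x : ℝ²} {m M R K₁ K₂ L : ℝ}

lemma norm_gradient_eq (u : ℝ² → ℝ) (x : ℝ²) : ‖gradient u x‖ = ‖fderiv ℝ u x‖ :=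
  (InnerProductSpace.toDual ℝ ℝ²).symm.norm_map _

lemma hessDet_basisFun (u : ℝ² → ℝ) (x : ℝ²) :
    hessDet (EuclideanSpace.basisFun (Fin 2) ℝ) u x = (hessian u x).det := by
  simp [hessDet, hessian]

lemma fderiv_fderiv_apply_eq_sum (u : ℝ² → ℝ) (x ξ : ℝ²) :
    fderiv ℝ (fderiv ℝ u) x ξ ξ = ∑ i, ∑ j, ξ i * ξ j * hessian u x i j := by
  nth_rw 1 2 [← (EuclideanSpace.basisFun (Fin 2) ℝ).sum_repr ξ]
  simp only [EuclideanSpace.basisFun_repr, EuclideanSpace.basisFun_apply, Fin.sum_univ_two, map_add,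
    map_smul, add_apply, smul_apply, smul_eq_mul, hessian, Matrix.of_apply]
  ring

lemma abs_fderiv_fderiv_le_hessianNorm (u : ℝ² → ℝ) (x : ℝ²) {ξ : ℝ²} (hξ : ‖ξ‖ = 1) :
    |fderiv ℝ (fderiv ℝ u) x ξ ξ| ≤ hessianNorm u x := by
  rw [hessianNorm, fderiv_fderiv_apply_eq_sum]
  apply Real.abs_le_sqrt
  have h := Finset.sum_mul_sq_le_sq_mul_sq (Finset.univ : Finset (Fin 2 × Fin 2))
    (fun p => ξ p.1 * ξ p.2) (fun p => hessian u x p.1 p.2)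
  have hξ' : ∑ p : Fin 2 × Fin 2, (ξ p.1 * ξ p.2) ^ 2 = 1 := by
    have : ∑ i, ξ i ^ 2 = 1 := by rw [← EuclideanSpace.real_norm_sq_eq, hξ, one_pow]
    simp only [mul_pow, Fintype.sum_prod_type, ← Finset.mul_sum, this, mul_one]
  rwa [hξ', one_mul, Fintype.sum_prod_type, Fintype.sum_prod_type] at h

lemma hessianNorm_le_of_det_pos {C : ℝ} (hdet : 0 < (hessian u x).det) (hu : ContDiffAt ℝ 2 u x)
    (hle : ∀ i, hessian u x i i ≤ C) (hnonneg : ∀ i, 0 ≤ hessian u x i i) :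
    hessianNorm u x ≤ 2 * C := by
  have hsymm : hessian u x 1 0 = hessian u x 0 1 := (hu.isSymmSndFDerivAt (by simp)).eq _ _
  rw [Matrix.det_fin_two, hsymm] at hdet
  have htr : hessian u x 0 0 + hessian u x 1 1 ≤ 2 * C := by linarith [hle 0, hle 1]
  refine Real.sqrt_le_iff.2 ⟨by linarith [hnonneg 0, hnonneg 1], ?_⟩
  simp only [Fin.sum_univ_two, hsymm]
  -- `|∇²u|² = (tr ∇²u)² - 2 det ∇²u ≤ (2 C)²`
  nlinarith [hnonneg 0, hnonneg 1]

lemma IsBoundedSolution.of_solvesGaussCurvatureEq (hu : ContDiffOn ℝ 4 u (ball 0 R))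
    (hconv : ConvexOn ℝ (ball 0 R) u) (hsol : SolvesGaussCurvatureEq u f R)
    (hf : ∀ x ∈ ball (0 : ℝ²) R, m ≤ f x ∧ f x ≤ M)
    (hf₁ : ∀ x ∈ ball (0 : ℝ²) R, ‖gradient f x‖ ≤ K₁)
    (hf₂ : ∀ x ∈ ball (0 : ℝ²) R, hessianNorm f x ≤ K₂)
    (hgrad : ∀ x ∈ ball (0 : ℝ²) R, ‖gradient u x‖ ≤ L) :
    IsBoundedSolution m (max M (max K₁ K₂)) L R u f where
  contDiffOn := hu
  convexOn := hconv
  hessDet_eq b x hx := by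
    have h := hsol x hx
    rwa [div_eq_iff (by positivity), ← hessDet_basisFun, norm_gradient_eq,
      hessDet_eq_hessDet _ b] at h
  le_curvature x hx := (hf x hx).1
  curvature_le x hx := (hf x hx).2.trans (le_max_left _ _)
  norm_fderiv_curvature_le x hx := (norm_gradient_eq f x).ge.trans
    ((hf₁ x hx).trans ((le_max_left _ _).trans (le_max_right _ _)))
  abs_fderiv_fderiv_curvature_le x hx _ hξ := (abs_fderiv_fderiv_le_hessianNorm f x hξ).trans
    ((hf₂ x hx).trans ((le_max_right _ _).trans (le_max_right _ _)))
  norm_fderiv_le x hx := (norm_gradient_eq u x).ge.trans (hgrad x hx)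

lemma IsBoundedSolution.hessianNorm_zero_le {Λ C : ℝ} (hsol : IsBoundedSolution m Λ L R u f)
    (hm : 0 < m) (hR : 0 < R) (hC : ∀ ξ, ‖ξ‖ = 1 → fderiv ℝ (fderiv ℝ u) 0 ξ ξ ≤ C) :
    hessianNorm u 0 ≤ 2 * C := by
  have h₀ : (0 : ℝ²) ∈ ball 0 R := mem_ball_self hR
  have hu : ContDiffAt ℝ 2 u 0 := (hsol.contDiffAt h₀).of_le (by norm_num)
  refine hessianNorm_le_of_det_pos ?_ hu (fun i => hC _ (by simp)) fun i => ?_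
  · rw [← hessDet_basisFun]
    exact hm.trans_le (hsol.le_hessDet hm _ h₀)
  · have h := dirDeriv_dirDeriv_nonneg hsol.convexOn (isOpen_ball.mem_nhds h₀) hu
      (EuclideanSpace.single i 1)
    rwa [dirDeriv_dirDeriv hu] at h

end EuclideanPlane

theorem theorem1p1 (m M R K₁ K₂ L : ℝ) (hm : 0 < m) (hR : 0 < R) :
    ∃ C : ℝ, 0 < C ∧
      ∀ u f : EuclideanSpace ℝ (Fin 2) → ℝ,
        ContDiffOn ℝ 4 u (Metric.ball 0 R) →
        ConvexOn ℝ (Metric.ball 0 R) u →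
        SolvesGaussCurvatureEq u f R →
        (∀ x ∈ Metric.ball (0 : EuclideanSpace ℝ (Fin 2)) R, m ≤ f x ∧ f x ≤ M) →
        (∀ x ∈ Metric.ball (0 : EuclideanSpace ℝ (Fin 2)) R, ‖gradient f x‖ ≤ K₁) →
        (∀ x ∈ Metric.ball (0 : EuclideanSpace ℝ (Fin 2)) R, hessianNorm f x ≤ K₂) →
        (∀ x ∈ Metric.ball (0 : EuclideanSpace ℝ (Fin 2)) R, ‖gradient u x‖ ≤ L) →
        hessianNorm u 0 ≤ C := by
  obtain ⟨C, hC⟩ := exists_fderiv_fderiv_le hm hR (abs_nonneg L)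
    (EuclideanSpace.basisFun (Fin 2) ℝ) (max M (max K₁ K₂))
  refine ⟨max 1 (2 * C), by positivity, fun u f hu hconv hsol hf hf₁ hf₂ hgrad => ?_⟩
  have hbdd := IsBoundedSolution.of_solvesGaussCurvatureEq hu hconv hsol hf hf₁
    hf₂ fun x hx => (hgrad x hx).trans (le_abs_self L)
  exact (hbdd.hessianNorm_zero_le hm hR (hC u f hbdd)).trans (le_max_right _ _)
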